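/- Let $\alpha>0$, $\lambda>0$ and $H=\tfrac12+\alpha$. Let $\{Z_j\}_{j\in\mathbb Z}$ be i.i.d. real random variables with mean zero and finite variance $\sigma^2$. For $n\ge 1$ put $$C_j^{\lambda/n}=\frac{1}{\Gamma(\alpha)}\,j^{\alpha-1}e^{-\lambda j/n}\ (j\ge 1),\qquad C_j^{\lambda/n}=0\ (j\le 0),\qquad Y_k^{\lambda/n}=\sum_{j\in\mathbb Z}C_j^{\lambda/n}Z_{k-j},$$ and let $$S_n(t)=\sum_{k=1}^{[t]}Y_k^{\lambda/n}+(t-[t])\,Y_{[t]+1}^{\lambda/n},\qquad t\ge 0,$$ be the interpolated partial sums, where $[t]$ is the integer part of $t$. Let $B(dy)$ be an independently scattered Gaussian random measure on $\mathbb R$ with control measure $\sigma^2\,dy$, and let $$Z^1_{H,\lambda}(t)=\int_{\mathbb R}\Big(\int_0^t (s-y)_+^{H-\frac32}e^{-\lambda(s-y)_+}\,ds\Big)B(dy),\qquad 0\le t\le 1,$$ be the tempered Hermite process of order one, where $(x)_+^{p}=x^p$ for $x>0$ and $(x)_+^{p}=0$ for $x\le 0$. Then the following hold. (i) For all $n\ge1$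 and $k\in\mathbb Z$ the series that defines $Y_k^{\lambda/n}$ converges absolutely almost surely. (ii) $Z^1_{H,\lambda}$ has a version with continuous paths on $[0,1]$, and, for this version, $$n^{-H}S_n(nt)\ \Rightarrow\ \frac{1}{\Gamma(\alpha)}\,Z^1_{H,\lambda}(t)\qquad (n\to\infty)$$ weakly in $C[0,1]$, the space of continuous functions on $[0,1]$ with the supremum norm. (iii) If $\tfrac12<H<1$, there is a constant $C$ such that for all $n\ge1$ and all $t_1,t_2\in[0,1]$ $$\mathbb E\Big[\big|n^{-H}S_n(nt_2)-n^{-H}S_n(nt_1)\big|^2\Big]\le C\,|t_2-t_1|^{2H}.$$ -/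

import Mathlib

open MeasureTheory ProbabilityTheory Filter Topology
open scoped NNReal ENNReal

/-! ### The space `C[0,1]` with its Borel σ-algebra -/

/-- The space of continuous real functions on `[0,1]`, with the supremum metric, carries its Borel
σ-algebra. -/
instance continuousMapUnitIntervalMeasurableSpace : MeasurableSpace C(unitInterval, ℝ) :=
  borel C(unitInterval, ℝ)

instance continuousMapUnitIntervalBorelSpace : BorelSpace C(unitInterval, ℝ) := ⟨rfl⟩

namespace TemperedHermite

/-! ### Tempered linear processes and their interpolated partial sums -/

section Discrete

/-- The coefficients `C_j^μ = j^(α-1) e^(-μ j) / Γ(α)` for `j ≥ 1`, and `C_j^μ = 0` for `j ≤ 0`;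
`μ` is the tempering parameter. -/
noncomputable def coeff (α μ : ℝ) (j : ℤ) : ℝ :=
  if 1 ≤ j then (1 / Real.Gamma α) * (j : ℝ) ^ (α - 1) * Real.exp (-(μ * (j : ℝ))) else 0

/-- The tempered linear process `Y_k^μ = ∑_{j ∈ ℤ} C_j^μ Z_{k-j}`. -/
noncomputable def linearProcess {Ω : Type*} (α μ : ℝ) (Z : ℤ → Ω → ℝ) (k : ℤ) (ω : Ω) : ℝ :=
  ∑' j : ℤ, coeff α μ j * Z (k - j) ω

/-- The interpolated partial sums `∑_{k=1}^{[t]} y_k + (t - [t]) y_{[t]+1}`, for `t ≥ 0`. -/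
noncomputable def partialSum (y : ℕ → ℝ) (t : ℝ) : ℝ :=
  ∑ k ∈ Finset.Icc 1 ⌊t⌋₊, y k + (t - (⌊t⌋₊ : ℝ)) * y (⌊t⌋₊ + 1)

theorem partialSum_eq (y : ℕ → ℝ) (N : ℕ) {t : ℝ} (h0 : 0 ≤ t) (hN : t ≤ N) :
    partialSum y t = ∑ k ∈ Finset.range N, max 0 (min 1 (t - k)) * y (k + 1) := by
  have hf : (⌊t⌋₊ : ℝ) ≤ t := Nat.floor_le h0
  have hf' : t < (⌊t⌋₊ : ℝ) + 1 := Nat.lt_floor_add_one t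
  have hmN : ⌊t⌋₊ ≤ N := by exact_mod_cast hf.trans hN
  have hpart : ∑ k ∈ Finset.Icc 1 ⌊t⌋₊, y k =
      ∑ k ∈ Finset.range ⌊t⌋₊, max 0 (min 1 (t - k)) * y (k + 1) := by
    rw [Finset.range_eq_Ico, ← Finset.Ico_add_one_right_eq_Icc,
      ← Finset.sum_Ico_add' y 0 ⌊t⌋₊ 1]
    refine Finset.sum_congr rfl fun k hk => ?_
    have hk' : k + 1 ≤ ⌊t⌋₊ := (Finset.mem_Ico.1 hk).2
    have hk'' : (k : ℝ) + 1 ≤ ⌊t⌋₊ := by exact_mod_cast hk'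
    rw [min_eq_left (by linarith), max_eq_right zero_le_one, one_mul]
  have hzero : ∀ k : ℕ, ⌊t⌋₊ + 1 ≤ k → max 0 (min 1 (t - k)) * y (k + 1) = 0 := by
    intro k hk
    have hk' : (⌊t⌋₊ : ℝ) + 1 ≤ k := by exact_mod_cast hk
    rw [max_eq_left ((min_le_right _ _).trans (by linarith)), zero_mul]
  rw [partialSum, hpart]
  rcases hmN.eq_or_lt with h | h
  · have : t = (⌊t⌋₊ : ℝ) := le_antisymm (hN.trans (by rw [h])) hf
    rw [← this, sub_self, zero_mul, add_zero, h]
  · rw [← Finset.sum_subset (Finset.range_mono h)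
      (fun k _ hk => hzero k (by simpa using hk)), Finset.sum_range_succ,
      min_eq_right (by linarith), max_eq_right (by linarith)]

/-- The path `t ↦ n^(-H) S(nt)`, `0 ≤ t ≤ 1`, where `S` are the interpolated partial sums of
`Y_1, Y_2, …`, as an element of `C[0,1]`. -/
noncomputable def scaledPath (H : ℝ) (n : ℕ) (y : ℕ → ℝ) : C(unitInterval, ℝ) where
  toFun t := (n : ℝ) ^ (-H) * partialSum y (n * (t : ℝ))
  continuous_toFun := by
    have h : (fun t : unitInterval => (n : ℝ) ^ (-H) * partialSum y (n * (t : ℝ))) =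
        fun t : unitInterval => (n : ℝ) ^ (-H) *
          ∑ k ∈ Finset.range n, max 0 (min 1 ((n : ℝ) * t - k)) * y (k + 1) := by
      funext t
      rw [partialSum_eq y n (mul_nonneg n.cast_nonneg t.2.1)
        (mul_le_of_le_one_right n.cast_nonneg t.2.2)]
    rw [h]
    fun_prop

/-- The random element `n^(-H) S_n^(lam/n)(n t)`, `0 ≤ t ≤ 1`, of `C[0,1]`: the scaled partial sums
of the tempered linear process with tempering parameter `lam / n`. -/
noncomputable def scaledPartialSum {Ω : Type*} (α H lam : ℝ) (Z : ℤ → Ω → ℝ) (n : ℕ) (ω : Ω) :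
    C(unitInterval, ℝ) :=
  scaledPath H n (fun k => linearProcess α (lam / n) Z k ω)

end Discrete

/-! ### Gaussian random measures, Wiener integrals and the tempered Hermite process -/

section Continuous

/-- `B` is an independently scattered Gaussian random measure on `ℝ` with control measure `v dx`:
to Borel sets `A` of finite Lebesgue measure it assigns centred Gaussian random variables `B A` of
variance `v |A|`, independent for disjoint sets, and it is σ-additive in mean square. -/
structure IsGaussianRandomMeasure {Ω : Type*} [MeasurableSpace Ω] (B : Set ℝ → Ω → ℝ) (v : ℝ≥0)
    (P : Measure Ω) : Prop where
  hasLaw : ∀ A : Set ℝ, MeasurableSet A → volume A < ∞ →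
    HasLaw (B A) (gaussianReal 0 (v * (volume A).toNNReal)) P
  indep : ∀ (m : ℕ) (A : Fin m → Set ℝ), (∀ i, MeasurableSet (A i)) → (∀ i, volume (A i) < ∞) →
    Pairwise (fun i j => Disjoint (A i) (A j)) → iIndepFun (fun i => B (A i)) P
  additive : ∀ A : ℕ → Set ℝ, (∀ i, MeasurableSet (A i)) → volume (⋃ i, A i) < ∞ →
    Pairwise (fun i j => Disjoint (A i) (A j)) →
    Tendsto (fun m : ℕ => eLpNorm (fun ω => B (⋃ i, A i) ω - ∑ i ∈ Finset.range m, B (A i) ω) 2 P)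
      atTop (𝓝 0)

/-- The integral `∫ φ dB = ∑_c c B({φ = c})` of a simple function `φ` (with support of finite
Lebesgue measure) against the random measure `B`. -/
noncomputable def simpleIntegral {Ω : Type*} (B : Set ℝ → Ω → ℝ) (φ : SimpleFunc ℝ ℝ) (ω : Ω) :
    ℝ :=
  ∑ c ∈ φ.range, c * B (φ ⁻¹' {c}) ω

/-- `X` is (a version of) the Wiener integral `∫ f dB` of `f ∈ L²(ℝ, dx)`: the limit in `L²(P)` of
the integrals of simple functions that converge to `f` in `L²(ℝ, dx)`. -/
def IsWienerIntegral {Ω : Type*} [MeasurableSpace Ω] (B : Set ℝ → Ω → ℝ) (P : Measure Ω)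
    (f : ℝ → ℝ) (X : Ω → ℝ) : Prop :=
  MemLp f 2 volume ∧ MemLp X 2 P ∧ ∃ φ : ℕ → SimpleFunc ℝ ℝ,
    (∀ m, MemLp (φ m) 2 volume) ∧
    Tendsto (fun m => eLpNorm (fun y => φ m y - f y) 2 volume) atTop (𝓝 0) ∧
    Tendsto (fun m => eLpNorm (fun ω => simpleIntegral B (φ m) ω - X ω) 2 P) atTop (𝓝 0)

/-- The function `x ↦ (x)_+^p e^(-lam (x)_+)`, which vanishes for `x ≤ 0`. -/
noncomputable def temperedPower (p lam x : ℝ) : ℝ :=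
  if 0 < x then x ^ p * Real.exp (-(lam * x)) else 0

/-- The kernel `g_{H,lam,t}(y) = ∫_0^t (s-y)_+^(H-3/2) e^(-lam (s-y)_+) ds`. -/
noncomputable def kernel (H lam t y : ℝ) : ℝ :=
  ∫ s in (0 : ℝ)..t, temperedPower (H - 3 / 2) lam (s - y)

/-- The random element `ζ` of `C[0,1]` is a version with continuous paths of the tempered Hermite
process of order one `Z^1_{H,lam}(t) = ∫ g_{H,lam,t}(y) B(dy)`, `0 ≤ t ≤ 1`. -/
def IsTemperedHermite {Ω : Type*} [MeasurableSpace Ω] (B : Set ℝ → Ω → ℝ) (P : Measure Ω)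
    (H lam : ℝ) (ζ : Ω → C(unitInterval, ℝ)) : Prop :=
  AEMeasurable ζ P ∧
    ∀ t : unitInterval, IsWienerIntegral B P (kernel H lam (t : ℝ)) (fun ω => ζ ω t)

end Continuous

end TemperedHermite

/-! Grouping the innovations, `n^(-H) S_n(n t) = ∑ j, w_n(t, j) Z j` with deterministic weights.
Because the tempering parameter is `lam / n`, the weights are a discretization of the kernel of the
limit: `w_n(t, j) = n^(-1/2) Γ(α)⁻¹ ∫ s in 0..t, k(⌈n s⌉/n - j/n)` with `k = temperedPower (H - 3/2)
lam`. Sums over `j` of squared weights are therefore integrals in `y = j / n` of squared step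
kernels, which are dominated by `(s - y)_+^(β-1)` with the same constant as the kernel itself.
Domination gives the moment bound `C |t - s|^(1 + 2β)`, for every `β ≤ α` with `0 < β < 1/2`,
uniformly in `n` and for the limit; dominated convergence gives convergence of the variances.

No central limit theorem for arrays is needed for the marginals: the weights tend to `0` uniformly
in `j`, so each characteristic function is within `ε ∑ j, w²` of the Gaussian one. Tightness is
replaced by chaining: the moment bound makes the dyadic polygonal interpolations approximate the
paths in mean square of the supremum norm, uniformly in `n`, and the interpolations depend
continuously on finitely many marginals. The same chaining constructs the continuous version of the
limit. -/

namespace TemperedHermite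

/-! ### Polygonal interpolation on the unit interval -/

section Polygon

/-- The ramp `t ↦ (N t - k)` truncated to `[0,1]`, which climbs from `0` to `1` between the nodes
`k / N` and `(k + 1) / N`. -/
noncomputable def ramp (N k : ℕ) : C(unitInterval, ℝ) :=
  ⟨fun t => max 0 (min 1 ((N : ℝ) * t - k)), by fun_prop⟩

/-- The polygonal path through the points `(k / N, x k)`, `0 ≤ k ≤ N`, written as a combination of
ramps so that it is visibly linear in the increments of `x`. -/
noncomputable def polygon (N : ℕ) (x : ℕ → ℝ) : C(unitInterval, ℝ) :=
  ContinuousMap.const _ (x 0) + ∑ k ∈ Finset.range N, (x (k + 1) - x k) • ramp N k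

/-- The node `k / N` of the uniform grid, clamped to the unit interval. -/
noncomputable def node (N k : ℕ) : unitInterval :=
  Set.projIcc 0 1 zero_le_one ((k : ℝ) / N)

theorem ramp_apply (N k : ℕ) (t : unitInterval) :
    ramp N k t = max 0 (min 1 ((N : ℝ) * t - k)) := rfl

theorem ramp_nonneg (N k : ℕ) (t : unitInterval) : 0 ≤ ramp N k t := le_max_left _ _

theorem ramp_le_one (N k : ℕ) (t : unitInterval) : ramp N k t ≤ 1 :=
  max_le zero_le_one (min_le_left _ _)

theorem ramp_succ_le (N k : ℕ) (t : unitInterval) : ramp N (k + 1) t ≤ ramp N k t := by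
  simp only [ramp_apply]
  push_cast
  gcongr
  linarith

theorem ramp_eq_half_add (N k : ℕ) (t : unitInterval) :
    ramp N k t = (ramp (2 * N) (2 * k) t + ramp (2 * N) (2 * k + 1) t) / 2 := by
  simp only [ramp_apply]
  push_cast
  grind

theorem polygon_apply (N : ℕ) (x : ℕ → ℝ) (t : unitInterval) :
    polygon N x t = x 0 + ∑ k ∈ Finset.range N, (x (k + 1) - x k) * ramp N k t := by
  simp [polygon, ContinuousMap.sum_apply]

theorem continuous_polygon (N : ℕ) : Continuous (polygon N) := by
  unfold polygon
  fun_prop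

theorem polygon_congr {N : ℕ} {x y : ℕ → ℝ} (h : ∀ k ≤ N, x k = y k) :
    polygon N x = polygon N y := by
  ext t
  rw [polygon_apply, polygon_apply, h 0 N.zero_le]
  congr 1
  refine Finset.sum_congr rfl fun k hk => ?_
  have hk : k < N := Finset.mem_range.1 hk
  rw [h k hk.le, h (k + 1) hk]

theorem polygon_eq_segment (N : ℕ) (x : ℕ → ℝ) (t : unitInterval) :
    polygon N x t = x ⌊(N : ℝ) * t⌋₊ +
      ((N : ℝ) * t - ⌊(N : ℝ) * t⌋₊) * (x (⌊(N : ℝ) * t⌋₊ + 1) - x ⌊(N : ℝ) * t⌋₊) := by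
  have hpart := partialSum_eq (fun k => x k - x (k - 1)) N (mul_nonneg N.cast_nonneg t.2.1)
    (mul_le_of_le_one_right N.cast_nonneg t.2.2)
  have htel (m : ℕ) : ∑ k ∈ Finset.Icc 1 m, (x k - x (k - 1)) = x m - x 0 := by
    induction m with
    | zero => simp
    | succ m ih => rw [Finset.sum_Icc_succ_top (by lia), ih]; simp
  rw [partialSum, htel] at hpart
  simp only [polygon_apply, ramp_apply, mul_comm (x _ - x _), Nat.add_sub_cancel] at hpart ⊢
  rw [← hpart]
  ring

theorem abs_polygon_sub_le (N : ℕ) (x : ℕ → ℝ) (t : unitInterval) (c : ℝ) :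
    |polygon N x t - c| ≤
      max |x ⌊(N : ℝ) * t⌋₊ - c| |x (⌊(N : ℝ) * t⌋₊ + 1) - c| := by
  have hfloor := Nat.floor_le (mul_nonneg N.cast_nonneg t.2.1 : 0 ≤ (N : ℝ) * t)
  have hlt := Nat.lt_floor_add_one ((N : ℝ) * t)
  rw [polygon_eq_segment]
  set k := ⌊(N : ℝ) * t⌋₊
  set θ := (N : ℝ) * t - k
  have h0 : 0 ≤ θ := by linarith
  have h1 : 0 ≤ 1 - θ := by linarith
  calc |x k + θ * (x (k + 1) - x k) - c|
      = |(1 - θ) * (x k - c) + θ * (x (k + 1) - c)| := by ring_nf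
    _ ≤ (1 - θ) * |x k - c| + θ * |x (k + 1) - c| := by
      simpa only [abs_mul, abs_of_nonneg h0, abs_of_nonneg h1] using
        abs_add_le ((1 - θ) * (x k - c)) (θ * (x (k + 1) - c))
    _ ≤ (1 - θ) * max |x k - c| |x (k + 1) - c| + θ * max |x k - c| |x (k + 1) - c| := by
      gcongr
      exacts [le_max_left _ _, le_max_right _ _]
    _ = max |x k - c| |x (k + 1) - c| := by ring

theorem node_two_mul (N k : ℕ) : node (2 * N) (2 * k) = node N k := by
  unfold node
  push_cast
  rw [mul_div_mul_left _ _ two_ne_zero]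

theorem abs_node_sub_le {N k : ℕ} (hN : 0 < N) {t : unitInterval}
    (hk : |(k : ℝ) - N * t| ≤ 1) : |(node N k : ℝ) - t| ≤ 1 / N := by
  have hN' : (0 : ℝ) < N := by exact_mod_cast hN
  have hproj := Set.abs_projIcc_sub_projIcc (zero_le_one (α := ℝ)) (c := (k : ℝ) / N) (d := t)
  rw [Set.projIcc_val] at hproj
  calc |(node N k : ℝ) - t| ≤ |(k : ℝ) / N - t| := hproj
    _ = |(k : ℝ) - N * t| / N := by rw [← abs_of_pos hN', ← abs_div, abs_of_pos hN']; field_simp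
    _ ≤ 1 / N := by gcongr

theorem abs_node_succ_sub_le (N k : ℕ) : |(node N (k + 1) : ℝ) - node N k| ≤ 1 / N := by
  refine (Set.abs_projIcc_sub_projIcc (zero_le_one (α := ℝ))).trans_eq ?_
  rw [← sub_div]
  push_cast
  rw [add_sub_cancel_left, abs_of_nonneg (by positivity)]

theorem tendsto_polygon_node (f : C(unitInterval, ℝ)) :
    Tendsto (fun N : ℕ => polygon N (fun k => f (node N k))) atTop (𝓝 f) := by
  rw [Metric.tendsto_atTop']
  intro ε hε
  obtain ⟨δ, hδ, hf⟩ := Metric.uniformContinuous_iff.1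
    (CompactSpace.uniformContinuous_of_continuous f.continuous) ε hε
  obtain ⟨N₀, hN₀⟩ := exists_nat_gt (1 / δ)
  refine ⟨N₀, fun N hN => (ContinuousMap.dist_lt_iff hε).2 fun t => ?_⟩
  have hN0 : 0 < N := hN.pos
  have hNδ : 1 / (N : ℝ) < δ := by
    rw [one_div_lt (by positivity) hδ]
    exact hN₀.trans (by exact_mod_cast hN)
  have hclose (k : ℕ) (hk : |(k : ℝ) - N * t| ≤ 1) : |f (node N k) - f t| < ε :=
    hf ((abs_node_sub_le hN0 hk).trans_lt hNδ)
  have hfloor := Nat.floor_le (mul_nonneg N.cast_nonneg t.2.1 : 0 ≤ (N : ℝ) * t)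
  have hlt := Nat.lt_floor_add_one ((N : ℝ) * t)
  refine (abs_polygon_sub_le N _ t (f t)).trans_lt (max_lt (hclose _ ?_) (hclose _ ?_))
  · rw [abs_le]; constructor <;> linarith
  · push_cast; rw [abs_le]; constructor <;> linarith

theorem sum_range_two_mul {M : Type*} [AddCommMonoid M] (f : ℕ → M) (N : ℕ) :
    ∑ k ∈ Finset.range (2 * N), f k = ∑ k ∈ Finset.range N, (f (2 * k) + f (2 * k + 1)) := by
  induction N with
  | zero => simp
  | succ N ih =>
    rw [Finset.sum_range_succ, ← ih, mul_add_one, Finset.sum_range_succ, Finset.sum_range_succ,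
      add_assoc]

-- `ramp (2 * N) (2 * k) - ramp (2 * N) (2 * k + 1)` is the tent (Schauder function) centred at the
-- midpoint of the `k`-th interval of the coarse grid.
theorem polygon_two_mul_sub (N : ℕ) (x : ℕ → ℝ) (t : unitInterval) :
    polygon (2 * N) x t - polygon N (fun k => x (2 * k)) t =
      ∑ k ∈ Finset.range N, (ramp (2 * N) (2 * k) t - ramp (2 * N) (2 * k + 1) t) *
        (((x (2 * k + 1) - x (2 * k)) - (x (2 * k + 1 + 1) - x (2 * k + 1))) / 2) := by
  rw [polygon_apply, polygon_apply, sum_range_two_mul, mul_zero, add_sub_add_left_eq_sub,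
    ← Finset.sum_sub_distrib]
  refine Finset.sum_congr rfl fun k _ => ?_
  rw [ramp_eq_half_add N k t, mul_add_one]
  ring

theorem sum_ramp_sub_ramp_sq_le_one (N : ℕ) (t : unitInterval) :
    ∑ k ∈ Finset.range N, (ramp (2 * N) (2 * k) t - ramp (2 * N) (2 * k + 1) t) ^ 2 ≤ 1 := by
  have hterm (k : ℕ) : (ramp (2 * N) (2 * k) t - ramp (2 * N) (2 * k + 1) t) ^ 2 ≤
      ramp (2 * N) (2 * k) t - ramp (2 * N) (2 * (k + 1)) t := by
    have hle := ramp_succ_le (2 * N) (2 * k) t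
    have hle' : ramp (2 * N) (2 * (k + 1)) t ≤ ramp (2 * N) (2 * k + 1) t :=
      ramp_succ_le (2 * N) (2 * k + 1) t
    have h1 := ramp_le_one (2 * N) (2 * k) t
    have h0 := ramp_nonneg (2 * N) (2 * k + 1) t
    nlinarith
  calc _ ≤ ∑ k ∈ Finset.range N, (ramp (2 * N) (2 * k) t - ramp (2 * N) (2 * (k + 1)) t) :=
        Finset.sum_le_sum fun k _ => hterm k
    _ = ramp (2 * N) (2 * 0) t - ramp (2 * N) (2 * N) t := Finset.sum_range_sub' _ _
    _ ≤ 1 := by linarith [ramp_le_one (2 * N) (2 * 0) t, ramp_nonneg (2 * N) (2 * N) t]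

theorem norm_polygon_two_mul_sub_sq_le (N : ℕ) (x : ℕ → ℝ) :
    ‖polygon (2 * N) x - polygon N (fun k => x (2 * k))‖ ^ 2 ≤
      ∑ k ∈ Finset.range (2 * N), (x (k + 1) - x k) ^ 2 := by
  have hnonneg (M : ℕ) (y : ℕ → ℝ) : 0 ≤ ∑ k ∈ Finset.range M, y k ^ 2 :=
    Finset.sum_nonneg fun _ _ => sq_nonneg _
  rw [← Real.le_sqrt (norm_nonneg _) (hnonneg _ _), ContinuousMap.norm_le _ (Real.sqrt_nonneg _)]
  refine fun t => Real.le_sqrt_of_sq_le ?_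
  rw [Real.norm_eq_abs, sq_abs, ContinuousMap.sub_apply, polygon_two_mul_sub]
  refine (Finset.sum_mul_sq_le_sq_mul_sq _ _ _).trans ?_
  refine (mul_le_of_le_one_left (hnonneg _ _) (sum_ramp_sub_ramp_sq_le_one N t)).trans ?_
  rw [sum_range_two_mul]
  refine Finset.sum_le_sum fun k _ => ?_
  nlinarith [sq_nonneg (x (2 * k + 1) - x (2 * k)), sq_nonneg (x (2 * k + 1 + 1) - x (2 * k + 1)),
    sq_nonneg ((x (2 * k + 1) - x (2 * k)) + (x (2 * k + 1 + 1) - x (2 * k + 1)))]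

end Polygon

/-! ### Chaining along dyadic polygonal approximations -/

section Chaining

variable {Ω : Type*} {mΩ : MeasurableSpace Ω} {P : Measure Ω}

theorem sq_eLpNorm_two {E : Type*} [NormedAddCommGroup E] (f : Ω → E) :
    eLpNorm f 2 P ^ 2 = ∫⁻ ω, ‖f ω‖ₑ ^ 2 ∂P := by
  have h := eLpNorm_nnreal_pow_eq_lintegral (f := f) (μ := P) (p := 2) two_ne_zero
  simpa using h

theorem eLpNorm_two_le_ofReal {E : Type*} [NormedAddCommGroup E] {f : Ω → E} {c : ℝ}
    (hc : 0 ≤ c) (h : ∫⁻ ω, ‖f ω‖ₑ ^ 2 ∂P ≤ ENNReal.ofReal (c ^ 2)) :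
    eLpNorm f 2 P ≤ ENNReal.ofReal c := by
  rwa [← ENNReal.pow_le_pow_left_iff two_ne_zero, sq_eLpNorm_two, ← ENNReal.ofReal_pow hc]

theorem memLp_sum_smul {ι E : Type*} [NormedAddCommGroup E] [NormedSpace ℝ E] {p : ℝ≥0∞}
    (s : Finset ι) {f : ι → Ω → ℝ} (hf : ∀ i ∈ s, MemLp (f i) p P) (v : ι → E) :
    MemLp (fun ω => ∑ i ∈ s, f i ω • v i) p P :=
  memLp_finsetSum s fun i hi => by
    simpa only [Function.comp_def, ContinuousLinearMap.toSpanSingleton_apply] using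
      (ContinuousLinearMap.toSpanSingleton ℝ (v i)).comp_memLp' (hf i hi)

theorem eLpNorm_sub_le_sum {E : Type*} [NormedAddCommGroup E] {p : ℝ≥0∞} (hp : 1 ≤ p)
    {f : ℕ → Ω → E} (hf : ∀ n, AEStronglyMeasurable (f n) P) (m n : ℕ) :
    eLpNorm (f (m + n) - f m) p P ≤
      ∑ i ∈ Finset.range n, eLpNorm (f (m + i + 1) - f (m + i)) p P := by
  rw [← Nat.add_zero m, Nat.add_assoc, Nat.zero_add,
    ← Finset.sum_range_sub (fun i => f (m + i)) n]
  exact eLpNorm_sum_le (fun i _ => (hf _).sub (hf _)) hp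

/-- The moment condition of the Kolmogorov–Chentsov theorem with second moments,
`E |x t - x s|² ≤ K |t - s|^(1 + γ)`; the second moment is a lower Lebesgue integral, so that the
condition includes its finiteness. -/
def IncrementBound (P : Measure Ω) (x : unitInterval → Ω → ℝ) (K : ℝ≥0) (γ : ℝ) : Prop :=
  ∀ s t : unitInterval, ∫⁻ ω, ‖x t ω - x s ω‖ₑ ^ 2 ∂P ≤
    ENNReal.ofReal (K * |(t : ℝ) - s| ^ (1 + γ))

/-- The polygonal interpolation of the process `x` at the points `k / N`. -/
noncomputable def gridPolygon (x : unitInterval → Ω → ℝ) (N : ℕ) (ω : Ω) : C(unitInterval, ℝ) :=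
  polygon N (fun k => x (node N k) ω)

/-- The ratio of the geometric series that bounds the dyadic approximations in mean square. -/
noncomputable def chainRatio (γ : ℝ) : ℝ := 2 ^ (-γ / 2)

/-- The bound `∑_{i > m} √K r^i`, `r = chainRatio γ`, for the distance in mean square between a
process and its polygonal interpolation of mesh `2^(-m)`. -/
noncomputable def chainBound (K : ℝ≥0) (γ : ℝ) (m : ℕ) : ℝ :=
  √K * chainRatio γ ^ (m + 1) / (1 - chainRatio γ)

variable {x : unitInterval → Ω → ℝ} {K K' : ℝ≥0} {γ : ℝ}

theorem IncrementBound.mono (h : IncrementBound P x K γ) (hK : K ≤ K') :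
    IncrementBound P x K' γ := fun s t =>
  (h s t).trans (ENNReal.ofReal_le_ofReal (by gcongr))

theorem IncrementBound.const_mul (h : IncrementBound P x K γ) (c : ℝ) :
    IncrementBound P (fun t ω => c * x t ω) (‖c‖₊ ^ 2 * K) γ := by
  intro s t
  simp only [← mul_sub, enorm_mul, mul_pow]
  rw [lintegral_const_mul' _ _ (by finiteness)]
  calc ‖c‖ₑ ^ 2 * ∫⁻ ω, ‖x t ω - x s ω‖ₑ ^ 2 ∂P
      ≤ ‖c‖ₑ ^ 2 * ENNReal.ofReal (K * |(t : ℝ) - s| ^ (1 + γ)) := by gcongr; exact h s t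
    _ = _ := by
      rw [← ofReal_norm, ← ENNReal.ofReal_pow (norm_nonneg c), ← ENNReal.ofReal_mul (by positivity)]
      push_cast
      rw [mul_assoc]

theorem IncrementBound.congr {y : unitInterval → Ω → ℝ} (h : IncrementBound P x K γ)
    (hxy : ∀ t, y t =ᵐ[P] x t) : IncrementBound P y K γ := by
  intro s t
  refine (lintegral_congr_ae ?_).trans_le (h s t)
  filter_upwards [hxy s, hxy t] with ω hs ht
  rw [hs, ht]

theorem IncrementBound.eLpNorm_sub_le (h : IncrementBound P x K γ) (s t : unitInterval) :
    eLpNorm (x t - x s) 2 P ≤ ENNReal.ofReal √(K * |(t : ℝ) - s| ^ (1 + γ)) := by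
  refine eLpNorm_two_le_ofReal (Real.sqrt_nonneg _) ((h s t).trans_eq ?_)
  rw [Real.sq_sqrt (by positivity)]

theorem aemeasurable_gridPolygon (hx : ∀ t, AEMeasurable (x t) P) (N : ℕ) :
    AEMeasurable (gridPolygon x N) P :=
  (continuous_polygon _).measurable.comp_aemeasurable
    (aemeasurable_pi_lambda _ fun k => hx (node N k))

theorem memLp_gridPolygon {p : ℝ≥0∞} (hx : ∀ t, MemLp (x t) p P) (N : ℕ) :
    MemLp (gridPolygon x N) p P := by
  have hconst := (ContinuousLinearMap.toSpanSingleton ℝ (1 : C(unitInterval, ℝ))).comp_memLp'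
    (hx (node N 0))
  have hsum := memLp_sum_smul (Finset.range N)
    (fun k _ => (hx (node N (k + 1))).sub (hx (node N k))) (ramp N)
  refine (hconst.add hsum).ae_eq (ae_of_all _ fun ω => ?_)
  ext t
  simp [gridPolygon, polygon_apply]

theorem enorm_gridPolygon_two_mul_sub_sq_le (x : unitInterval → Ω → ℝ) (N : ℕ) (ω : Ω) :
    ‖gridPolygon x (2 * N) ω - gridPolygon x N ω‖ₑ ^ 2 ≤
      ∑ k ∈ Finset.range (2 * N), ‖x (node (2 * N) (k + 1)) ω - x (node (2 * N) k) ω‖ₑ ^ 2 := by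
  have h := ENNReal.ofReal_le_ofReal
    (norm_polygon_two_mul_sub_sq_le N fun k => x (node (2 * N) k) ω)
  simp only [node_two_mul] at h
  rw [ENNReal.ofReal_sum_of_nonneg fun _ _ => sq_nonneg _, ENNReal.ofReal_pow (norm_nonneg _),
    ofReal_norm] at h
  refine h.trans_eq (Finset.sum_congr rfl fun k _ => ?_)
  rw [← sq_abs, ENNReal.ofReal_pow (abs_nonneg _), ← Real.norm_eq_abs, ofReal_norm]

theorem lintegral_gridPolygon_two_mul_sub_le (hx : ∀ t, AEMeasurable (x t) P)
    (hγ : 0 < 1 + γ) (h : IncrementBound P x K γ) {N : ℕ} (hN : 0 < N) :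
    ∫⁻ ω, ‖gridPolygon x (2 * N) ω - gridPolygon x N ω‖ₑ ^ 2 ∂P ≤
      ENNReal.ofReal (K * (2 * N : ℝ) ^ (-γ)) := by
  calc ∫⁻ ω, ‖gridPolygon x (2 * N) ω - gridPolygon x N ω‖ₑ ^ 2 ∂P
      ≤ ∫⁻ ω, ∑ k ∈ Finset.range (2 * N),
          ‖x (node (2 * N) (k + 1)) ω - x (node (2 * N) k) ω‖ₑ ^ 2 ∂P :=
        lintegral_mono fun ω => enorm_gridPolygon_two_mul_sub_sq_le x N ω
    _ = ∑ k ∈ Finset.range (2 * N),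
          ∫⁻ ω, ‖x (node (2 * N) (k + 1)) ω - x (node (2 * N) k) ω‖ₑ ^ 2 ∂P :=
        lintegral_finsetSum' _ fun k _ => ((hx _).sub (hx _)).enorm.pow_const 2
    _ ≤ ∑ _k ∈ Finset.range (2 * N), ENNReal.ofReal (K * (1 / (2 * N : ℝ)) ^ (1 + γ)) := by
        refine Finset.sum_le_sum fun k _ => (h _ _).trans (ENNReal.ofReal_le_ofReal ?_)
        gcongr
        exact_mod_cast abs_node_succ_sub_le (2 * N) k
    _ = ENNReal.ofReal (K * (2 * N : ℝ) ^ (-γ)) := by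
        have hN' : (0 : ℝ) < 2 * N := by positivity
        rw [Finset.sum_const, Finset.card_range, nsmul_eq_mul, ← ENNReal.ofReal_natCast,
          ← ENNReal.ofReal_mul (by positivity), one_div, Real.inv_rpow hN'.le,
          Real.rpow_add hN', Real.rpow_one, Real.rpow_neg hN'.le]
        push_cast
        congr 1
        field_simp

theorem chainRatio_pos (γ : ℝ) : 0 < chainRatio γ := Real.rpow_pos_of_pos two_pos _

theorem chainRatio_lt_one (hγ : 0 < γ) : chainRatio γ < 1 :=
  Real.rpow_lt_one_of_one_lt_of_neg one_lt_two (by linarith)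

theorem sq_chainRatio_pow (γ : ℝ) (m : ℕ) : (chainRatio γ ^ m) ^ 2 = ((2 : ℝ) ^ m) ^ (-γ) := by
  rw [chainRatio, Real.rpow_pow_comm zero_le_two, ← Real.rpow_mul_natCast (by positivity)]
  push_cast
  ring_nf

theorem tendsto_chainBound (K : ℝ≥0) (hγ : 0 < γ) :
    Tendsto (chainBound K γ) atTop (𝓝 0) := by
  have hpow := (tendsto_pow_atTop_nhds_zero_of_lt_one (chainRatio_pos γ).le
    (chainRatio_lt_one hγ)).comp (tendsto_add_atTop_nat 1)
  have h := (hpow.const_mul √K).div_const (1 - chainRatio γ)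
  rwa [mul_zero, zero_div] at h

theorem eLpNorm_gridPolygon_succ_sub_le (hx : ∀ t, AEMeasurable (x t) P) (hγ : 0 < γ)
    (h : IncrementBound P x K γ) (m : ℕ) :
    eLpNorm (gridPolygon x (2 ^ (m + 1)) - gridPolygon x (2 ^ m)) 2 P ≤
      ENNReal.ofReal (√K * chainRatio γ ^ (m + 1)) := by
  have hr := chainRatio_pos γ
  refine eLpNorm_two_le_ofReal (by positivity) ?_
  have hsq : (√K * chainRatio γ ^ (m + 1)) ^ 2 = K * (2 * ((2 ^ m : ℕ) : ℝ)) ^ (-γ) := by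
    rw [mul_pow, Real.sq_sqrt K.coe_nonneg, sq_chainRatio_pow, pow_succ', Nat.cast_pow,
      Nat.cast_ofNat]
  rw [hsq, pow_succ']
  exact lintegral_gridPolygon_two_mul_sub_le hx (by linarith) h (by positivity)

theorem eLpNorm_gridPolygon_add_sub_le (hx : ∀ t, AEMeasurable (x t) P) (hγ : 0 < γ)
    (h : IncrementBound P x K γ) (m p : ℕ) :
    eLpNorm (gridPolygon x (2 ^ (m + p)) - gridPolygon x (2 ^ m)) 2 P ≤
      ENNReal.ofReal (chainBound K γ m) := by
  have hr := chainRatio_pos γ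
  have hmeas (m : ℕ) : AEStronglyMeasurable (gridPolygon x (2 ^ m)) P :=
    (aemeasurable_gridPolygon hx _).aestronglyMeasurable
  calc eLpNorm (gridPolygon x (2 ^ (m + p)) - gridPolygon x (2 ^ m)) 2 P
      ≤ ∑ i ∈ Finset.range p,
          eLpNorm (gridPolygon x (2 ^ (m + i + 1)) - gridPolygon x (2 ^ (m + i))) 2 P :=
        eLpNorm_sub_le_sum one_le_two hmeas m p
    _ ≤ ∑ i ∈ Finset.range p, ENNReal.ofReal (√K * chainRatio γ ^ (m + i + 1)) :=
        Finset.sum_le_sum fun i _ => eLpNorm_gridPolygon_succ_sub_le hx hγ h (m + i)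
    _ = ENNReal.ofReal (√K * chainRatio γ ^ (m + 1) * ∑ i ∈ Finset.range p, chainRatio γ ^ i) := by
        rw [← ENNReal.ofReal_sum_of_nonneg fun _ _ => by positivity, Finset.mul_sum]
        ring_nf
    _ ≤ ENNReal.ofReal (chainBound K γ m) := by
        rw [chainBound, div_eq_mul_inv, ← tsum_geometric_of_lt_one hr.le (chainRatio_lt_one hγ)]
        gcongr
        exact (summable_geometric_of_lt_one hr.le (chainRatio_lt_one hγ)).sum_le_tsum _
          fun _ _ => by positivity

theorem eLpNorm_sub_gridPolygon_le {F : Ω → C(unitInterval, ℝ)} (hF : AEMeasurable F P)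
    (hγ : 0 < γ) (h : IncrementBound P (fun t ω => F ω t) K γ) (m : ℕ) :
    eLpNorm (fun ω => F ω - gridPolygon (fun t ω => F ω t) (2 ^ m) ω) 2 P ≤
      ENNReal.ofReal (chainBound K γ m) := by
  have hx (t : unitInterval) : AEMeasurable (fun ω => F ω t) P :=
    (continuous_eval_const t).measurable.comp_aemeasurable hF
  have hmeas (m : ℕ) : AEStronglyMeasurable (gridPolygon (fun t ω => F ω t) (2 ^ m)) P :=
    (aemeasurable_gridPolygon hx _).aestronglyMeasurable
  refine Lp.eLpNorm_le_of_ae_tendsto (u := atTop)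
    (Eventually.of_forall fun p => eLpNorm_gridPolygon_add_sub_le hx hγ h m p)
    (fun p => (hmeas _).sub (hmeas _)) (ae_of_all _ fun ω => Tendsto.sub_const ?_ _)
  have hpow : Tendsto (fun p => 2 ^ (m + p)) atTop (atTop : Filter ℕ) :=
    (tendsto_pow_atTop_atTop_of_one_lt one_lt_two).comp (tendsto_add_atTop_nat m |>.congr
      fun p => add_comm p m)
  exact (tendsto_polygon_node (F ω)).comp hpow

theorem eLpNorm_gridPolygon_apply_sub_le (hx : ∀ t, AEMeasurable (x t) P) (hγ : 0 < 1 + γ)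
    (h : IncrementBound P x K γ) {N : ℕ} (hN : 0 < N) (t : unitInterval) :
    eLpNorm (fun ω => gridPolygon x N ω t - x t ω) 2 P ≤
      ENNReal.ofReal (2 * √(K * (1 / N : ℝ) ^ (1 + γ))) := by
  have hnode (k : ℕ) (hk : |(k : ℝ) - N * t| ≤ 1) :
      eLpNorm (x (node N k) - x t) 2 P ≤ ENNReal.ofReal √(K * (1 / N : ℝ) ^ (1 + γ)) := by
    refine (h.eLpNorm_sub_le t (node N k)).trans (ENNReal.ofReal_le_ofReal ?_)
    gcongr
    exact abs_node_sub_le hN hk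
  have hfloor := Nat.floor_le (mul_nonneg N.cast_nonneg t.2.1 : 0 ≤ (N : ℝ) * t)
  have hlt := Nat.lt_floor_add_one ((N : ℝ) * t)
  set k := ⌊(N : ℝ) * t⌋₊
  calc eLpNorm (fun ω => gridPolygon x N ω t - x t ω) 2 P
      ≤ eLpNorm (fun ω => |x (node N k) ω - x t ω| + |x (node N (k + 1)) ω - x t ω|) 2 P :=
        eLpNorm_mono_real fun ω => (abs_polygon_sub_le N _ t (x t ω)).trans
          (max_le_add_of_nonneg (abs_nonneg _) (abs_nonneg _))
    _ ≤ eLpNorm (fun ω => ‖(x (node N k) - x t) ω‖) 2 P +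
          eLpNorm (fun ω => ‖(x (node N (k + 1)) - x t) ω‖) 2 P :=
        eLpNorm_add_le ((hx _).sub (hx _)).aestronglyMeasurable.norm
          ((hx _).sub (hx _)).aestronglyMeasurable.norm one_le_two
    _ ≤ _ := by
        rw [eLpNorm_norm, eLpNorm_norm, two_mul, ENNReal.ofReal_add (by positivity) (by positivity)]
        refine add_le_add (hnode k ?_) (hnode (k + 1) ?_)
        · rw [abs_le]; constructor <;> linarith
        · push_cast; rw [abs_le]; constructor <;> linarith

theorem tendsto_eLpNorm_gridPolygon_apply_sub (hx : ∀ t, AEMeasurable (x t) P) (hγ : 0 < 1 + γ)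
    (h : IncrementBound P x K γ) (t : unitInterval) :
    Tendsto (fun N => eLpNorm (fun ω => gridPolygon x N ω t - x t ω) 2 P) atTop (𝓝 0) := by
  have hbound : Tendsto (fun N : ℕ => ENNReal.ofReal (2 * √(K * (1 / N : ℝ) ^ (1 + γ)))) atTop
      (𝓝 0) := by
    have hcont : ContinuousAt (fun u : ℝ => ENNReal.ofReal (2 * √(K * u ^ (1 + γ)))) 0 := by
      have hpow := Real.continuousAt_rpow_const 0 (1 + γ) (Or.inr hγ.le)
      exact ENNReal.continuous_ofReal.continuousAt.comp (by fun_prop)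
    simpa [Function.comp_def, Real.zero_rpow hγ.ne'] using
      hcont.tendsto.comp tendsto_one_div_atTop_nhds_zero_nat
  refine tendsto_of_tendsto_of_tendsto_of_le_of_le' tendsto_const_nhds hbound
    (Eventually.of_forall fun _ => zero_le) ?_
  filter_upwards [eventually_gt_atTop 0] with N hN
  exact eLpNorm_gridPolygon_apply_sub_le hx hγ h hN t

theorem exists_tendsto_eLpNorm_gridPolygon (hx : ∀ t, MemLp (x t) 2 P) (hγ : 0 < γ)
    (h : IncrementBound P x K γ) :
    ∃ ζ : Ω → C(unitInterval, ℝ), MemLp ζ 2 P ∧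
      Tendsto (fun m => eLpNorm (gridPolygon x (2 ^ m) - ζ) 2 P) atTop (𝓝 0) := by
  have hmem (m : ℕ) := memLp_gridPolygon hx (2 ^ m)
  have hr := chainRatio_pos γ
  have hcauchy : CauchySeq fun m => (hmem m).toLp := by
    refine cauchySeq_of_edist_le_geometric (ENNReal.ofReal (chainRatio γ))
      (ENNReal.ofReal (√K * chainRatio γ)) (ENNReal.ofReal_lt_one.2 (chainRatio_lt_one hγ))
      ENNReal.ofReal_ne_top fun m => ?_
    rw [edist_comm, Lp.edist_toLp_toLp, ← ENNReal.ofReal_pow hr.le,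
      ← ENNReal.ofReal_mul (by positivity), mul_assoc, ← pow_succ']
    exact eLpNorm_gridPolygon_succ_sub_le (fun t => (hx t).1.aemeasurable) hγ h m
  obtain ⟨ζ, hζ⟩ := cauchySeq_tendsto_of_complete hcauchy
  refine ⟨ζ, Lp.memLp ζ, ?_⟩
  rwa [← Lp.toLp_coeFn ζ (Lp.memLp ζ), Lp.tendsto_Lp_iff_tendsto_eLpNorm''] at hζ

/-- A mean square version of the Kolmogorov–Chentsov theorem. -/
theorem exists_continuous_version (hx : ∀ t, MemLp (x t) 2 P) (hγ : 0 < γ)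
    (h : IncrementBound P x K γ) :
    ∃ ζ : Ω → C(unitInterval, ℝ), AEMeasurable ζ P ∧ ∀ t, (fun ω => ζ ω t) =ᵐ[P] x t := by
  obtain ⟨ζ, hζ, hlim⟩ := exists_tendsto_eLpNorm_gridPolygon hx hγ h
  refine ⟨ζ, hζ.1.aemeasurable, fun t => ?_⟩
  have heval {F : Ω → C(unitInterval, ℝ)} (hF : MemLp F 2 P) :
      AEStronglyMeasurable (fun ω => F ω t) P :=
    (continuous_eval_const t).comp_aestronglyMeasurable hF.1
  have hlim_x : Tendsto (fun m => eLpNorm ((gridPolygon x (2 ^ m) · t) - x t) 2 P) atTop (𝓝 0) :=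
    (tendsto_eLpNorm_gridPolygon_apply_sub (fun t => (hx t).1.aemeasurable) (by linarith) h t).comp
      (tendsto_pow_atTop_atTop_of_one_lt one_lt_two)
  have hlim_ζ : Tendsto (fun m => eLpNorm ((gridPolygon x (2 ^ m) · t) - (ζ · t)) 2 P) atTop
      (𝓝 0) :=
    tendsto_of_tendsto_of_tendsto_of_le_of_le tendsto_const_nhds hlim (fun _ => zero_le) fun m =>
      eLpNorm_mono fun ω => ContinuousMap.norm_coe_le_norm (gridPolygon x (2 ^ m) ω - ζ ω) t
  exact tendstoInMeasure_ae_unique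
    (tendstoInMeasure_of_tendsto_eLpNorm two_ne_zero
      (fun m => heval (memLp_gridPolygon hx _)) (heval hζ) hlim_ζ)
    (tendstoInMeasure_of_tendsto_eLpNorm two_ne_zero
      (fun m => heval (memLp_gridPolygon hx _)) (hx t).1 hlim_x)

end Chaining

/-! ### Criteria for convergence in distribution -/

section ConvergenceInDistribution

variable {Ω Ω' : Type*} {mΩ : MeasurableSpace Ω} {mΩ' : MeasurableSpace Ω'}
  {P : Measure Ω} {P' : Measure Ω'}

theorem aemeasurable_toLp {J : Type*} [Finite J] {X : J → Ω → ℝ}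
    (hX : ∀ k, AEMeasurable (X k) P) : AEMeasurable (fun ω => WithLp.toLp 2 (X · ω)) P :=
  (PiLp.continuous_toLp 2 _).measurable.comp_aemeasurable (aemeasurable_pi_lambda _ hX)

theorem charFun_map_toLp {J : Type*} [Fintype J] {X : J → Ω → ℝ}
    (hX : ∀ k, AEMeasurable (X k) P) (a : EuclideanSpace ℝ J) :
    charFun (P.map fun ω => WithLp.toLp 2 (X · ω)) a =
      ∫ ω, Complex.exp ((∑ k, a k * X k ω : ℝ) * Complex.I) ∂P := by
  rw [charFun_apply, integral_map (aemeasurable_toLp hX)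
    (by fun_prop : Continuous _).aestronglyMeasurable]
  simp [PiLp.inner_apply]

variable [IsProbabilityMeasure P] [IsProbabilityMeasure P']

theorem abs_integral_map_sub_le_of_lipschitz {E : Type*} [NormedAddCommGroup E]
    [MeasurableSpace E] [BorelSpace E] [SecondCountableTopology E] {X Y : Ω → E}
    (hX : AEMeasurable X P) (hY : AEMeasurable Y P) {f : E → ℝ} {C : ℝ}
    (hf : ∀ x y, dist (f x) (f y) ≤ C) {L : ℝ≥0} (hL : LipschitzWith L f) {p : ℝ≥0∞}
    (hp : 1 ≤ p) {b : ℝ≥0} (h : eLpNorm (fun ω => X ω - Y ω) p P ≤ b) :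
    |∫ z, f z ∂(P.map X) - ∫ z, f z ∂(P.map Y)| ≤ L * b := by
  have hint {W : Ω → E} (hW : AEMeasurable W P) : Integrable (fun ω => f (W ω)) P := by
    have := Measure.isProbabilityMeasure_map hW
    exact (BoundedContinuousFunction.integrable (P.map W)
      ⟨⟨f, hL.continuous⟩, C, hf⟩).comp_aemeasurable hW
  have hmeas : AEStronglyMeasurable (fun ω => X ω - Y ω) P :=
    hX.aestronglyMeasurable.sub hY.aestronglyMeasurable
  have hL1 : eLpNorm (fun ω => X ω - Y ω) 1 P ≤ b :=
    (eLpNorm_le_eLpNorm_of_exponent_le hp hmeas).trans h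
  have hXY : Integrable (fun ω => X ω - Y ω) P :=
    memLp_one_iff_integrable.1 ⟨hmeas, hL1.trans_lt ENNReal.coe_lt_top⟩
  rw [integral_map hX hL.continuous.aestronglyMeasurable,
    integral_map hY hL.continuous.aestronglyMeasurable, ← integral_sub (hint hX) (hint hY)]
  calc |∫ ω, (f (X ω) - f (Y ω)) ∂P| ≤ ∫ ω, |f (X ω) - f (Y ω)| ∂P := abs_integral_le_integral_abs
    _ ≤ ∫ ω, L * ‖X ω - Y ω‖ ∂P :=
        integral_mono ((hint hX).sub (hint hY)).abs (hXY.norm.const_mul _) fun ω => by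
          have := hL.dist_le_mul (X ω) (Y ω)
          rwa [Real.dist_eq, dist_eq_norm] at this
    _ = L * ∫ ω, ‖X ω - Y ω‖ ∂P := integral_const_mul _ _
    _ ≤ L * b := by
        gcongr
        rw [integral_norm_eq_lintegral_enorm hmeas, ← eLpNorm_one_eq_lintegral_enorm]
        exact ENNReal.toReal_le_coe_of_le_coe hL1

theorem tendstoInDistribution_of_approx {E ι κ : Type*} [NormedAddCommGroup E]
    [MeasurableSpace E] [BorelSpace E] [SecondCountableTopology E] {l : Filter ι}
    [l.IsCountablyGenerated] {l' : Filter κ} [l'.NeBot] {F : ι → Ω → E} {G : Ω' → E}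
    {FA : κ → ι → Ω → E} {GA : κ → Ω' → E}
    (hF : ∀ n, AEMeasurable (F n) P) (hG : AEMeasurable G P') {p : ℝ≥0∞} (hp : 1 ≤ p)
    {b : κ → ℝ≥0} (hb : Tendsto b l' (𝓝 0))
    (hFA : ∀ m, ∀ᶠ n in l, eLpNorm (fun ω => F n ω - FA m n ω) p P ≤ b m)
    (hGA : ∀ m, eLpNorm (fun ω => G ω - GA m ω) p P' ≤ b m)
    (h : ∀ m, TendstoInDistribution (FA m) l (GA m) (fun _ => P) P') :
    TendstoInDistribution F l G (fun _ => P) P' := by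
  refine ⟨hF, hG, tendsto_iff_forall_lipschitz_integral_tendsto.2 ?_⟩
  rintro f ⟨C, hC⟩ ⟨L, hL⟩
  simp only [ProbabilityMeasure.coe_mk]
  have hFA_lim (m : κ) : Tendsto (fun n => ∫ z, f z ∂(P.map (FA m n))) l
      (𝓝 (∫ z, f z ∂(P'.map (GA m)))) :=
    tendsto_iff_forall_lipschitz_integral_tendsto.1 (h m).tendsto f ⟨C, hC⟩ ⟨L, hL⟩
  rw [Metric.tendsto_nhds]
  intro ε hε
  have hsmall : Tendsto (fun m => (L : ℝ) * b m) l' (𝓝 0) := by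
    simpa using (NNReal.tendsto_coe.2 hb).const_mul (L : ℝ)
  obtain ⟨m, hm⟩ := (hsmall.eventually_lt_const (show 0 < ε / 3 by positivity)).exists
  filter_upwards [hFA m, Metric.tendsto_nhds.1 (hFA_lim m) (ε / 3) (by positivity)]
    with n hn hlim
  have hdistF := abs_integral_map_sub_le_of_lipschitz (hF n) ((h m).forall_aemeasurable n)
    hC hL hp hn
  have hdistG :=
    abs_integral_map_sub_le_of_lipschitz hG (h m).aemeasurable_limit hC hL hp (hGA m)
  rw [← Real.dist_eq] at hdistF hdistG
  rw [dist_comm] at hdistG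
  linarith [dist_triangle4 (∫ z, f z ∂(P.map (F n))) (∫ z, f z ∂(P.map (FA m n)))
    (∫ z, f z ∂(P'.map (GA m))) (∫ z, f z ∂(P'.map G))]

/-- The Cramér–Wold device. -/
theorem tendstoInDistribution_toLp_of_charFun {J : Type*} [Fintype J] {X : ℕ → J → Ω → ℝ}
    {Y : J → Ω' → ℝ} (hX : ∀ n k, AEMeasurable (X n k) P) (hY : ∀ k, AEMeasurable (Y k) P')
    (h : ∀ a : J → ℝ, Tendsto
      (fun n => ∫ ω, Complex.exp ((∑ k, a k * X n k ω : ℝ) * Complex.I) ∂P) atTop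
      (𝓝 (∫ ω, Complex.exp ((∑ k, a k * Y k ω : ℝ) * Complex.I) ∂P'))) :
    TendstoInDistribution (fun n ω => WithLp.toLp 2 (X n · ω)) atTop
      (fun ω => WithLp.toLp 2 (Y · ω)) (fun _ => P) P' := by
  refine ⟨fun n => aemeasurable_toLp (hX n), aemeasurable_toLp hY,
    ProbabilityMeasure.tendsto_of_tendsto_charFun fun a => ?_⟩
  simpa only [ProbabilityMeasure.coe_mk, charFun_map_toLp (hX _), charFun_map_toLp hY] using h a

theorem tendstoInDistribution_gridPolygon {x : ℕ → unitInterval → Ω → ℝ}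
    {y : unitInterval → Ω' → ℝ} {N : ℕ}
    (h : TendstoInDistribution (fun n ω => WithLp.toLp 2 fun k : Fin (N + 1) => x n (node N k) ω)
      atTop (fun ω => WithLp.toLp 2 fun k : Fin (N + 1) => y (node N k) ω) (fun _ => P) P') :
    TendstoInDistribution (fun n => gridPolygon (x n) N) atTop (gridPolygon y N)
      (fun _ => P) P' := by
  let g (v : EuclideanSpace ℝ (Fin (N + 1))) : C(unitInterval, ℝ) :=
    polygon N fun k => v (Fin.ofNat (N + 1) k)
  have hg : Continuous g := (continuous_polygon N).comp (continuous_pi fun k => by fun_prop)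
  have hgrid (f : unitInterval → ℝ) :
      g (WithLp.toLp 2 fun k : Fin (N + 1) => f (node N k)) = polygon N fun k => f (node N k) :=
    polygon_congr fun k hk => by simp [Fin.ofNat, Nat.mod_eq_of_lt (Nat.lt_succ_of_le hk)]
  refine (h.continuous_comp hg).congr (fun n => ?_) ?_
  · exact ae_of_all _ fun ω => hgrid (x n · ω)
  · exact ae_of_all _ fun ω => hgrid (y · ω)

theorem tendstoInDistribution_of_charFun {F : ℕ → Ω → C(unitInterval, ℝ)}
    {G : Ω' → C(unitInterval, ℝ)} (hF : ∀ n, AEMeasurable (F n) P) (hG : AEMeasurable G P')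
    {K : ℝ≥0} {γ : ℝ} (hγ : 0 < γ)
    (hFb : ∀ᶠ n in atTop, IncrementBound P (fun t ω => F n ω t) K γ)
    (hGb : IncrementBound P' (fun t ω => G ω t) K γ)
    (hchar : ∀ (N : ℕ) (a : Fin N → ℝ) (t : Fin N → unitInterval),
      Tendsto (fun n => ∫ ω, Complex.exp ((∑ k, a k * F n ω (t k) : ℝ) * Complex.I) ∂P) atTop
        (𝓝 (∫ ω, Complex.exp ((∑ k, a k * G ω (t k) : ℝ) * Complex.I) ∂P'))) :
    TendstoInDistribution F atTop G (fun _ => P) P' := by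
  have heval (t : unitInterval) : Measurable fun f : C(unitInterval, ℝ) => f t :=
    (continuous_eval_const t).measurable
  refine tendstoInDistribution_of_approx (l' := atTop) hF hG one_le_two
    (b := fun m => (chainBound K γ m).toNNReal)
    (FA := fun m n => gridPolygon (fun t ω => F n ω t) (2 ^ m))
    (GA := fun m => gridPolygon (fun t ω => G ω t) (2 ^ m)) ?_
    (fun m => hFb.mono fun n hn => eLpNorm_sub_gridPolygon_le (hF n) hγ hn m)
    (fun m => eLpNorm_sub_gridPolygon_le hG hγ hGb m) fun m => ?_
  · simpa using tendsto_real_toNNReal (tendsto_chainBound K hγ)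
  · exact tendstoInDistribution_gridPolygon (tendstoInDistribution_toLp_of_charFun
      (fun n k => (heval _).comp_aemeasurable (hF n)) (fun k => (heval _).comp_aemeasurable hG)
      fun a => hchar _ a _)

end ConvergenceInDistribution

/-! ### Weighted sums of independent identically distributed random variables -/

section WeightedSum

variable {Ω ι : Type*} {mΩ : MeasurableSpace Ω} {P : Measure Ω}

theorem summable_sq_of_summable_abs {d : ι → ℝ} (hd : Summable fun j => |d j|) :
    Summable fun j => d j ^ 2 := by
  refine summable_of_isBigO hd (Asymptotics.IsBigO.of_bound 1 ?_)
  filter_upwards [hd.tendsto_cofinite_zero.eventually_le_const zero_lt_one] with j hj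
  rw [Real.norm_eq_abs, Real.norm_eq_abs, abs_abs, one_mul, abs_pow, pow_two]
  exact mul_le_of_le_one_left (abs_nonneg _) hj

theorem ae_summable_mul [Countable ι] {Z : ι → Ω → ℝ} (hZ : ∀ j, AEMeasurable (Z j) P)
    {C : ℝ≥0} (hC : ∀ j, eLpNorm (Z j) 1 P ≤ C) {d : ι → ℝ} (hd : Summable fun j => |d j|) :
    ∀ᵐ ω ∂P, Summable fun j => d j * Z j ω := by
  have hfin : ∫⁻ ω, ∑' j, ‖d j * Z j ω‖ₑ ∂P ≠ ∞ := by
    refine ne_top_of_le_ne_top (b := ENNReal.ofReal (∑' j, |d j|) * C) (by finiteness) ?_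
    calc ∫⁻ ω, ∑' j, ‖d j * Z j ω‖ₑ ∂P = ∑' j, ‖d j‖ₑ * eLpNorm (Z j) 1 P := by
          rw [lintegral_tsum fun j => ((hZ j).const_mul (d j)).enorm]
          refine tsum_congr fun j => ?_
          simp only [enorm_mul, eLpNorm_one_eq_lintegral_enorm]
          exact lintegral_const_mul'' _ (hZ j).enorm
      _ ≤ ∑' j, ENNReal.ofReal |d j| * C := by
          gcongr with j
          · rw [Real.enorm_eq_ofReal_abs]
          · exact hC j
      _ = ENNReal.ofReal (∑' j, |d j|) * C := by
          rw [ENNReal.tsum_mul_right, ENNReal.ofReal_tsum_of_nonneg (fun _ => abs_nonneg _) hd]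
  have hmeas : AEMeasurable (fun ω => ∑' j, ‖d j * Z j ω‖ₑ) P :=
    AEMeasurable.tsum fun j => ((hZ j).const_mul (d j)).enorm
  filter_upwards [ae_lt_top' hmeas hfin] with ω hω
  exact Summable.of_norm (by simpa using ENNReal.summable_toReal hω.ne)

theorem integral_exp_finsetSum_mul {Z : ι → Ω → ℝ} (hindep : iIndepFun Z P)
    (hZ : ∀ j, AEMeasurable (Z j) P) (d : ι → ℝ) (s : Finset ι) :
    ∫ ω, Complex.exp ((∑ j ∈ s, d j * Z j ω : ℝ) * Complex.I) ∂P =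
      ∏ j ∈ s, charFun (P.map (Z j)) (d j) := by
  have hdZ (j : ι) : AEMeasurable (fun ω => d j * Z j ω) P := (hZ j).const_mul _
  have hindep_mul : iIndepFun (fun j ω => d j * Z j ω) P :=
    hindep.comp (fun j x => d j * x) fun j => measurable_const_mul (d j)
  have hprod := congrFun
    ((hindep_mul.restrict s).charFun_map_fun_finsetSum_eq_prod (s := s) fun j _ => hdZ j) 1
  rw [charFun_apply_real, integral_map (Finset.aemeasurable_fun_sum _ fun j _ => hdZ j)
    (by fun_prop), Finset.prod_apply] at hprod
  simp only [Complex.ofReal_one, one_mul] at hprod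
  rw [hprod]
  exact Finset.prod_congr rfl fun j _ => by rw [charFun_map_mul_comp (hZ j), mul_one]

theorem norm_prod_sub_prod_le (s : Finset ι) (a b : ι → ℂ) (ha : ∀ i, ‖a i‖ ≤ 1)
    (hb : ∀ i, ‖b i‖ ≤ 1) : ‖∏ i ∈ s, a i - ∏ i ∈ s, b i‖ ≤ ∑ i ∈ s, ‖a i - b i‖ := by
  classical
  induction s using Finset.induction_on with
  | empty => simp
  | insert i s hi ih =>
    rw [Finset.prod_insert hi, Finset.prod_insert hi, Finset.sum_insert hi]
    calc ‖a i * ∏ j ∈ s, a j - b i * ∏ j ∈ s, b j‖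
        = ‖(a i - b i) * ∏ j ∈ s, a j + b i * (∏ j ∈ s, a j - ∏ j ∈ s, b j)‖ := by ring_nf
      _ ≤ ‖a i - b i‖ * ∏ j ∈ s, ‖a j‖ + ‖b i‖ * ‖∏ j ∈ s, a j - ∏ j ∈ s, b j‖ := by
        rw [← norm_prod, ← norm_mul, ← norm_mul]
        exact norm_add_le _ _
      _ ≤ ‖a i - b i‖ + ∑ j ∈ s, ‖a j - b j‖ :=
        add_le_add (mul_le_of_le_one_right (norm_nonneg _)
          (Finset.prod_le_one (fun _ _ => norm_nonneg _) fun j _ => ha j))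
          ((mul_le_of_le_one_left (norm_nonneg _) (hb i)).trans ih)

theorem charFun_sub_isLittleO [IsProbabilityMeasure P] {X : Ω → ℝ} (hL2 : MemLp X 2 P)
    (hmean : ∫ ω, X ω ∂P = 0) :
    (fun t : ℝ => charFun (P.map X) t - (1 - (∫ ω, X ω ^ 2 ∂P) * t ^ 2 / 2 : ℝ)) =o[𝓝 0]
      fun t : ℝ => t ^ 2 := by
  have hX := hL2.1.aemeasurable
  have := Measure.isProbabilityMeasure_map hX
  have hid : MemLp id 2 (P.map X) := (memLp_map_measure_iff (by fun_prop) hX).2 hL2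
  have htaylor (t : ℝ) : taylorWithinEval (charFun (P.map X)) 2 Set.univ 0 t =
      (1 - (∫ ω, X ω ^ 2 ∂P) * t ^ 2 / 2 : ℝ) := by
    rw [taylorWithinEval_charFun_two_zero hX hid, hmean]
    simp
  simpa only [htaylor, sub_zero] using
    taylor_isLittleO_univ (n := 2) (x₀ := 0) (contDiff_charFun hid)

theorem charFun_sub_charFun_gaussianReal_isLittleO [IsProbabilityMeasure P] {X : Ω → ℝ}
    (hL2 : MemLp X 2 P) (hmean : ∫ ω, X ω ∂P = 0) {v : ℝ≥0} (hv : ∫ ω, X ω ^ 2 ∂P = v) :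
    (fun t : ℝ => charFun (P.map X) t - charFun (gaussianReal 0 v) t) =o[𝓝 0]
      fun t : ℝ => t ^ 2 := by
  have hgauss : ∫ x, id x ^ 2 ∂(gaussianReal 0 v) = v := by
    rw [← variance_of_integral_eq_zero aemeasurable_id integral_id_gaussianReal]
    exact variance_id_gaussianReal
  have h := (charFun_sub_isLittleO hL2 hmean).sub
    (charFun_sub_isLittleO (memLp_id_gaussianReal (v := v) 2) integral_id_gaussianReal)
  simpa only [hv, hgauss, Measure.map_id, sub_sub_sub_cancel_right] using h

/-- The variables `Z i` are independent and identically distributed, with mean zero and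
variance `v`. -/
structure IsCenteredIID (Z : ι → Ω → ℝ) (v : ℝ≥0) (P : Measure Ω) : Prop where
  indep : iIndepFun Z P
  ident : ∀ i j, IdentDistrib (Z i) (Z j) P P
  memLp : ∀ i, MemLp (Z i) 2 P
  mean : ∀ i, ∫ ω, Z i ω ∂P = 0
  sq : ∀ i, ∫ ω, Z i ω ^ 2 ∂P = v

variable {Z : ι → Ω → ℝ} {v : ℝ≥0} {d : ι → ℝ}

theorem isCenteredIID_of_identDistrib (hindep : iIndepFun Z P) (i₀ : ι)
    (hident : ∀ i, IdentDistrib (Z i) (Z i₀) P P) (hL2 : MemLp (Z i₀) 2 P)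
    (hmean : ∫ ω, Z i₀ ω ∂P = 0) (hv : ∫ ω, Z i₀ ω ^ 2 ∂P = v) : IsCenteredIID Z v P where
  indep := hindep
  ident i j := (hident i).trans (hident j).symm
  memLp i := (hident i).symm.memLp_snd hL2
  mean i := (hident i).integral_eq.trans hmean
  sq i := (hident i).sq.integral_eq.trans hv

namespace IsCenteredIID

theorem aemeasurable (h : IsCenteredIID Z v P) (i : ι) : AEMeasurable (Z i) P :=
  (h.memLp i).1.aemeasurable

variable [IsProbabilityMeasure P]

theorem lintegral_finsetSum_mul_sq (h : IsCenteredIID Z v P) (d : ι → ℝ) (s : Finset ι) :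
    ∫⁻ ω, ‖∑ j ∈ s, d j * Z j ω‖ₑ ^ 2 ∂P = ENNReal.ofReal (v * ∑ j ∈ s, d j ^ 2) := by
  have hdZ (j : ι) : MemLp (fun ω => d j * Z j ω) 2 P := (h.memLp j).const_mul _
  have hsum : MemLp (∑ j ∈ s, fun ω => d j * Z j ω) 2 P := memLp_finsetSum' _ fun j _ => hdZ j
  have hmean : ∫ ω, (∑ j ∈ s, fun ω => d j * Z j ω) ω ∂P = 0 := by
    simp only [Finset.sum_apply]
    rw [integral_finsetSum _ fun j _ => (hdZ j).integrable one_le_two]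
    simp only [integral_const_mul, h.mean, mul_zero, Finset.sum_const_zero]
  have hvar : ∫ ω, (∑ j ∈ s, d j * Z j ω) ^ 2 ∂P = v * ∑ j ∈ s, d j ^ 2 := by
    have hadd := IndepFun.variance_sum (μ := P) (s := s) (X := fun j ω => d j * Z j ω)
      (fun j _ => hdZ j) fun i _ j _ hij =>
        (h.indep.indepFun hij).comp (measurable_const_mul (d i)) (measurable_const_mul (d j))
    rw [variance_of_integral_eq_zero hsum.1.aemeasurable hmean] at hadd
    simpa only [variance_const_mul, variance_of_integral_eq_zero (h.aemeasurable _) (h.mean _),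
      h.sq, Finset.sum_apply, Finset.mul_sum, mul_comm _ (v : ℝ)] using hadd
  rw [← hvar, ofReal_integral_eq_lintegral_ofReal (by simpa using hsum.integrable_sq)
    (ae_of_all _ fun ω => sq_nonneg _)]
  refine lintegral_congr fun ω => ?_
  rw [← sq_abs, ENNReal.ofReal_pow (abs_nonneg _), ← Real.enorm_eq_ofReal_abs]

theorem ae_summable_mul [Countable ι] (h : IsCenteredIID Z v P) (hd : Summable fun j => |d j|) :
    ∀ᵐ ω ∂P, Summable fun j => d j * Z j ω := by
  refine TemperedHermite.ae_summable_mul (C := (√v).toNNReal) h.aemeasurable (fun j => ?_) hd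
  have hsq : ∫⁻ ω, ‖Z j ω‖ₑ ^ 2 ∂P = ENNReal.ofReal v := by
    simpa using h.lintegral_finsetSum_mul_sq (fun _ => 1) {j}
  refine (eLpNorm_le_eLpNorm_of_exponent_le one_le_two (h.memLp j).1).trans
    (eLpNorm_two_le_ofReal (Real.sqrt_nonneg _) ?_)
  rw [hsq, Real.sq_sqrt v.coe_nonneg]

theorem lintegral_tsum_mul_sq_le [Countable ι] (h : IsCenteredIID Z v P)
    (hd : Summable fun j => |d j|) :
    ∫⁻ ω, ‖∑' j, d j * Z j ω‖ₑ ^ 2 ∂P ≤ v * ∑' j, ‖d j‖ₑ ^ 2 := by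
  have hnonneg : 0 ≤ (v : ℝ) * ∑' j, d j ^ 2 := by positivity
  have hnorm : eLpNorm (fun ω => ∑' j, d j * Z j ω) 2 P ≤ ENNReal.ofReal √(v * ∑' j, d j ^ 2) := by
    refine Lp.eLpNorm_le_of_ae_tendsto (u := (atTop : Filter (Finset ι)))
      (f := fun s ω => ∑ j ∈ s, d j * Z j ω) (Eventually.of_forall fun s => ?_)
      (fun s => (Finset.aemeasurable_fun_sum _ fun j _ =>
        (h.aemeasurable j).const_mul (d j)).aestronglyMeasurable)
      ((h.ae_summable_mul hd).mono fun ω hω => hω.hasSum)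
    refine eLpNorm_two_le_ofReal (Real.sqrt_nonneg _) ?_
    rw [h.lintegral_finsetSum_mul_sq, Real.sq_sqrt hnonneg]
    gcongr
    exact (summable_sq_of_summable_abs hd).sum_le_tsum _ fun _ _ => sq_nonneg _
  rw [← sq_eLpNorm_two]
  calc eLpNorm (fun ω => ∑' j, d j * Z j ω) 2 P ^ 2 ≤ ENNReal.ofReal √(v * ∑' j, d j ^ 2) ^ 2 := by
        gcongr
    _ = ENNReal.ofReal (v * ∑' j, d j ^ 2) := by
        rw [← ENNReal.ofReal_pow (Real.sqrt_nonneg _), Real.sq_sqrt hnonneg]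
    _ = v * ∑' j, ‖d j‖ₑ ^ 2 := by
        rw [ENNReal.ofReal_mul v.coe_nonneg, ENNReal.ofReal_coe_nnreal,
          ENNReal.ofReal_tsum_of_nonneg (fun _ => sq_nonneg _) (summable_sq_of_summable_abs hd)]
        simp only [Real.enorm_eq_ofReal_abs, ← ENNReal.ofReal_pow (abs_nonneg _), sq_abs]

theorem exists_norm_integral_exp_finsetSum_sub_le [Nonempty ι] (h : IsCenteredIID Z v P)
    {ε : ℝ} (hε : 0 < ε) :
    ∃ δ > 0, ∀ (d : ι → ℝ) (s : Finset ι), (∀ j, |d j| < δ) →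
      ‖∫ ω, Complex.exp ((∑ j ∈ s, d j * Z j ω : ℝ) * Complex.I) ∂P -
        Complex.exp (-(v * (∑ j ∈ s, d j ^ 2) / 2) : ℝ)‖ ≤ ε * ∑ j ∈ s, d j ^ 2 := by
  let i₀ := Classical.arbitrary ι
  have := Measure.isProbabilityMeasure_map (h.aemeasurable i₀)
  obtain ⟨δ, hδ, hball⟩ := Metric.eventually_nhds_iff.1
    ((charFun_sub_charFun_gaussianReal_isLittleO (h.memLp i₀) (h.mean i₀) (h.sq i₀)).def hε)
  refine ⟨δ, hδ, fun d s hsmall => ?_⟩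
  have hgauss : Complex.exp (-(v * (∑ j ∈ s, d j ^ 2) / 2) : ℝ) =
      ∏ j ∈ s, charFun (gaussianReal 0 v) (d j) := by
    simp only [charFun_gaussianReal]
    rw [← Complex.exp_sum, Finset.mul_sum, Finset.sum_div, ← Finset.sum_neg_distrib]
    push_cast
    simp
  rw [integral_exp_finsetSum_mul h.indep h.aemeasurable, hgauss, Finset.mul_sum,
    Finset.prod_congr rfl fun j _ => by rw [(h.ident j i₀).map_eq]]
  refine (norm_prod_sub_prod_le s _ _ (fun j => norm_charFun_le_one _)
    fun j => norm_charFun_le_one _).trans (Finset.sum_le_sum fun j _ => ?_)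
  have hj := hball (y := d j) (by rw [Real.dist_eq, sub_zero]; exact hsmall j)
  rwa [Real.norm_of_nonneg (sq_nonneg _)] at hj

theorem tendsto_integral_exp_finsetSum [Countable ι] (h : IsCenteredIID Z v P)
    (hd : Summable fun j => |d j|) :
    Tendsto (fun s : Finset ι => ∫ ω, Complex.exp ((∑ j ∈ s, d j * Z j ω : ℝ) * Complex.I) ∂P)
      atTop (𝓝 (∫ ω, Complex.exp ((∑' j, d j * Z j ω : ℝ) * Complex.I) ∂P)) := by
  have hexp : Continuous fun x : ℝ => Complex.exp (x * Complex.I) := by fun_prop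
  refine tendsto_integral_filter_of_dominated_convergence (fun _ => 1)
    (Eventually.of_forall fun s => ?_) (Eventually.of_forall fun s => ae_of_all _ fun ω => ?_)
    (integrable_const _) ((h.ae_summable_mul hd).mono fun ω hω => (hexp.tendsto _).comp hω.hasSum)
  · exact hexp.comp_aestronglyMeasurable (Finset.aemeasurable_fun_sum _ fun j _ =>
      (h.aemeasurable j).const_mul _).aestronglyMeasurable
  · exact (Complex.norm_exp_ofReal_mul_I _).le

theorem exists_norm_integral_exp_tsum_sub_le [Countable ι] [Nonempty ι] (h : IsCenteredIID Z v P)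
    {ε : ℝ} (hε : 0 < ε) :
    ∃ δ > 0, ∀ d : ι → ℝ, (Summable fun j => |d j|) → (∀ j, |d j| < δ) →
      ‖∫ ω, Complex.exp ((∑' j, d j * Z j ω : ℝ) * Complex.I) ∂P -
        Complex.exp (-(v * (∑' j, d j ^ 2) / 2) : ℝ)‖ ≤ ε * ∑' j, d j ^ 2 := by
  obtain ⟨δ, hδ, hfin⟩ := h.exists_norm_integral_exp_finsetSum_sub_le hε
  refine ⟨δ, hδ, fun d hd hsmall => ?_⟩
  have hsq := (summable_sq_of_summable_abs hd).hasSum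
  have hgauss : Continuous fun x : ℝ => Complex.exp (-(v * x / 2) : ℝ) := by fun_prop
  exact le_of_tendsto_of_tendsto'
    ((h.tendsto_integral_exp_finsetSum hd).sub ((hgauss.tendsto _).comp hsq)).norm
    (hsq.const_mul ε) fun s => hfin d s hsmall

end IsCenteredIID

end WeightedSum

/-! ### Wiener integrals -/

section SquareIntegrable

variable {Ω : Type*} [MeasurableSpace Ω] {P : Measure Ω}

theorem lintegral_enorm_sq_eq_ofReal {f : Ω → ℝ} (hf : MemLp f 2 P) :
    ∫⁻ ω, ‖f ω‖ₑ ^ 2 ∂P = ENNReal.ofReal (∫ ω, f ω ^ 2 ∂P) := by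
  rw [ofReal_integral_eq_lintegral_ofReal hf.integrable_sq (ae_of_all _ fun _ => sq_nonneg _)]
  refine lintegral_congr fun ω => ?_
  rw [← sq_abs, ENNReal.ofReal_pow (abs_nonneg _), Real.enorm_eq_ofReal_abs]

theorem integral_sq_eq_eLpNorm {f : Ω → ℝ} (hf : MemLp f 2 P) :
    ∫ ω, f ω ^ 2 ∂P = (eLpNorm f 2 P).toReal ^ 2 := by
  rw [← ENNReal.toReal_pow, sq_eLpNorm_two, lintegral_enorm_sq_eq_ofReal hf,
    ENNReal.toReal_ofReal (integral_nonneg fun _ => sq_nonneg _)]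

theorem tendsto_integral_sq {ι : Type*} {l : Filter ι} {f : ι → Ω → ℝ} {g : Ω → ℝ}
    (hf : ∀ m, MemLp (f m) 2 P) (hg : MemLp g 2 P)
    (h : Tendsto (fun m => eLpNorm (fun ω => f m ω - g ω) 2 P) l (𝓝 0)) :
    Tendsto (fun m => ∫ ω, f m ω ^ 2 ∂P) l (𝓝 (∫ ω, g ω ^ 2 ∂P)) := by
  have hLp : Tendsto (fun m => (hf m).toLp (f m)) l (𝓝 (hg.toLp g)) :=
    (Lp.tendsto_Lp_iff_tendsto_eLpNorm'' f hf g hg).2 h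
  simpa only [Lp.norm_toLp, ← integral_sq_eq_eLpNorm (hf _), ← integral_sq_eq_eLpNorm hg]
    using hLp.norm.pow 2

theorem memLp_of_hasLaw_gaussianReal {X : Ω → ℝ} {μ : ℝ} {w : ℝ≥0}
    (hX : HasLaw X (gaussianReal μ w) P) : MemLp X 2 P := by
  have h := memLp_id_gaussianReal (μ := μ) (v := w) 2
  rw [← hX.map_eq] at h
  exact (memLp_map_measure_iff aestronglyMeasurable_id hX.aemeasurable).1 h

theorem integral_sq_of_hasLaw_gaussianReal {X : Ω → ℝ} {w : ℝ≥0}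
    (hX : HasLaw X (gaussianReal 0 w) P) : ∫ ω, X ω ^ 2 ∂P = w := by
  have hmean : ∫ ω, X ω ∂P = 0 := hX.integral_eq.trans integral_id_gaussianReal
  rw [← variance_of_integral_eq_zero hX.aemeasurable hmean, hX.variance_eq,
    variance_id_gaussianReal]

theorem hasLaw_gaussianReal_of_charFun [IsProbabilityMeasure P] {X : Ω → ℝ}
    (hX : AEMeasurable X P) {w : ℝ≥0}
    (h : ∀ θ : ℝ, charFun (P.map X) θ = Complex.exp (-(w * θ ^ 2 / 2) : ℝ)) :
    HasLaw X (gaussianReal 0 w) P := by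
  have := Measure.isProbabilityMeasure_map hX
  refine ⟨hX, Measure.ext_of_charFun (funext fun θ => ?_)⟩
  rw [h, charFun_gaussianReal]
  push_cast
  ring_nf

end SquareIntegrable

theorem simpleFunc_integral_sq {φ : SimpleFunc ℝ ℝ} (hφ : MemLp φ 2 volume) :
    ∫ y, φ y ^ 2 = ∑ c : φ.range.filter (· ≠ 0), (c : ℝ) ^ 2 * volume.real (φ ⁻¹' {(c : ℝ)}) := by
  have hint : Integrable φ volume :=
    (SimpleFunc.memLp_iff_integrable two_ne_zero ENNReal.ofNat_ne_top).1 hφ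
  calc ∫ y, φ y ^ 2 = ∫ y, φ.map (· ^ 2) y := rfl
    _ = ∑ c ∈ φ.range, volume.real (φ ⁻¹' {c}) • c ^ 2 := by
      rw [← SimpleFunc.map_integral φ (· ^ 2) hint (zero_pow two_ne_zero),
        SimpleFunc.integral_eq_integral]
      exact hφ.integrable_sq
    _ = ∑ c ∈ φ.range.filter (· ≠ 0), c ^ 2 * volume.real (φ ⁻¹' {c}) := by
      rw [Finset.sum_filter_of_ne fun c _ (hc : c ^ 2 * _ ≠ 0) =>
        ne_zero_pow two_ne_zero (left_ne_zero_of_mul hc)]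
      exact Finset.sum_congr rfl fun c _ => mul_comm _ _
    _ = _ := (Finset.sum_coe_sort _ fun c => c ^ 2 * volume.real (φ ⁻¹' {c})).symm

theorem simpleIntegral_eq_sum {Ω : Type*} (B : Set ℝ → Ω → ℝ) (φ : SimpleFunc ℝ ℝ) :
    simpleIntegral B φ =
      fun ω => ∑ c : φ.range.filter (· ≠ 0), (c : ℝ) * B (φ ⁻¹' {(c : ℝ)}) ω := by
  funext ω
  rw [Finset.sum_coe_sort _ fun c => c * B (φ ⁻¹' {c}) ω,
    Finset.sum_filter_of_ne fun c _ (hc : c * _ ≠ 0) => left_ne_zero_of_mul hc]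
  rfl

section Wiener

variable {Ω : Type*} [MeasurableSpace Ω] {P : Measure Ω} {B : Set ℝ → Ω → ℝ} {v : ℝ≥0}

namespace IsGaussianRandomMeasure

theorem memLp (hB : IsGaussianRandomMeasure B v P) {A : Set ℝ} (hA : MeasurableSet A)
    (hA' : volume A < ∞) : MemLp (B A) 2 P :=
  memLp_of_hasLaw_gaussianReal (hB.hasLaw A hA hA')

theorem empty_ae_eq (hB : IsGaussianRandomMeasure B v P) : B ∅ =ᵐ[P] 0 := by
  have h := hB.hasLaw ∅ MeasurableSet.empty (by simp)
  simp only [measure_empty, ENNReal.toNNReal_zero, mul_zero, gaussianReal_zero_var] at h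
  exact h.ae_eq_of_dirac

theorem iUnion_ae_eq_sum (hB : IsGaussianRandomMeasure B v P) {A : ℕ → Set ℝ}
    (hA : ∀ i, MeasurableSet (A i)) (hfin : volume (⋃ i, A i) < ∞)
    (hdisj : Pairwise fun i j => Disjoint (A i) (A j)) {N : ℕ} (hN : ∀ i, N ≤ i → A i = ∅) :
    B (⋃ i, A i) =ᵐ[P] fun ω => ∑ i ∈ Finset.range N, B (A i) ω := by
  have hmeas : AEStronglyMeasurable
      (fun ω => B (⋃ i, A i) ω - ∑ i ∈ Finset.range N, B (A i) ω) P :=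
    (hB.memLp (.iUnion hA) hfin).1.sub (Finset.aestronglyMeasurable_fun_sum _ fun i _ =>
      (hB.memLp (hA i) ((measure_mono (Set.subset_iUnion A i)).trans_lt hfin)).1)
  have hconst : ∀ᶠ m in atTop,
      eLpNorm (fun ω => B (⋃ i, A i) ω - ∑ i ∈ Finset.range m, B (A i) ω) 2 P =
        eLpNorm (fun ω => B (⋃ i, A i) ω - ∑ i ∈ Finset.range N, B (A i) ω) 2 P := by
    filter_upwards [eventually_ge_atTop N] with m hm
    refine eLpNorm_congr_ae ?_
    filter_upwards [hB.empty_ae_eq] with ω hω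
    rw [← Finset.sum_subset (Finset.range_subset_range.2 hm) fun i _ hi => by
      rw [hN i (not_lt.1 (mt Finset.mem_range.2 hi)), hω, Pi.zero_apply]]
  have hzero := tendsto_nhds_unique ((hB.additive A hA hfin hdisj).congr' hconst)
    tendsto_const_nhds
  filter_upwards [(eLpNorm_eq_zero_iff hmeas two_ne_zero).1 hzero.symm] with ω hω
  exact sub_eq_zero.1 hω

theorem union_ae_eq (hB : IsGaussianRandomMeasure B v P) {s t : Set ℝ} (hs : MeasurableSet s)
    (ht : MeasurableSet t) (hs' : volume s < ∞) (ht' : volume t < ∞) (hst : Disjoint s t) :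
    B (s ∪ t) =ᵐ[P] fun ω => B s ω + B t ω := by
  let A : ℕ → Set ℝ
    | 0 => s
    | 1 => t
    | _ + 2 => ∅
  have hU : ⋃ i, A i = s ∪ t := by
    ext x
    simp only [Set.mem_iUnion, Set.mem_union]
    constructor
    · rintro ⟨_ | _ | i, hi⟩
      exacts [Or.inl hi, Or.inr hi, hi.elim]
    · rintro (h | h)
      exacts [⟨0, h⟩, ⟨1, h⟩]
  have h := hB.iUnion_ae_eq_sum (A := A) (N := 2)
    (by rintro (_ | _ | _); exacts [hs, ht, .empty])
    (hU ▸ measure_union_lt_top hs' ht')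
    (by
      rintro (_ | _ | i) (_ | _ | j) hij
      all_goals first | exact absurd rfl hij | exact hst | exact hst.symm | simp [A])
    (by rintro (_ | _ | _) hi <;> first | omega | rfl)
  rw [hU] at h
  simpa only [Finset.sum_range_succ, Finset.sum_range_zero, zero_add] using h

theorem iIndepFun_of_disjoint (hB : IsGaussianRandomMeasure B v P) {ι : Type*} [Finite ι]
    {A : ι → Set ℝ} (hA : ∀ i, MeasurableSet (A i)) (hfin : ∀ i, volume (A i) < ∞)
    (hdisj : Pairwise fun i j => Disjoint (A i) (A j)) : iIndepFun (fun i => B (A i)) P := by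
  obtain ⟨m, ⟨e⟩⟩ := Finite.exists_equiv_fin ι
  have h := hB.indep m (fun k => A (e.symm k)) (fun _ => hA _) (fun _ => hfin _)
    fun k l hkl => hdisj (e.symm.injective.ne hkl)
  simpa only [Equiv.symm_apply_apply] using h.precomp e.injective

open Classical in
/-- The random measure as an additive set function with values in the operators `ℝ →L[ℝ] L²`, so
that `simpleIntegral B φ` becomes Mathlib's `SimpleFunc.setToSimpleFunc`; it is `0` on sets of
infinite measure. -/
noncomputable def toOperator (hB : IsGaussianRandomMeasure B v P) (A : Set ℝ) :
    ℝ →L[ℝ] Lp ℝ 2 P :=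
  if h : MeasurableSet A ∧ volume A < ∞ then
    ContinuousLinearMap.toSpanSingleton ℝ ((hB.memLp h.1 h.2).toLp (B A))
  else 0

theorem toOperator_apply (hB : IsGaussianRandomMeasure B v P) {A : Set ℝ} (hA : MeasurableSet A)
    (hA' : volume A < ∞) (c : ℝ) :
    hB.toOperator A c = c • (hB.memLp hA hA').toLp (B A) := by
  rw [toOperator, dif_pos ⟨hA, hA'⟩, ContinuousLinearMap.toSpanSingleton_apply]

theorem finMeasAdditive_toOperator (hB : IsGaussianRandomMeasure B v P) :
    FinMeasAdditive volume hB.toOperator := by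
  intro s t hs ht hs' ht' hst
  ext1
  rw [add_apply, hB.toOperator_apply hs hs'.lt_top, hB.toOperator_apply ht ht'.lt_top,
    hB.toOperator_apply (hs.union ht) (measure_union_lt_top hs'.lt_top ht'.lt_top), ← smul_add,
    ← MemLp.toLp_add]
  congr 1
  exact MemLp.toLp_congr _ _ (hB.union_ae_eq hs ht hs'.lt_top ht'.lt_top hst)

theorem coeFn_toOperator_preimage (hB : IsGaussianRandomMeasure B v P) {φ : SimpleFunc ℝ ℝ}
    (hφ : MemLp φ 2 volume) (c : ℝ) :
    hB.toOperator (φ ⁻¹' {c}) c =ᵐ[P] fun ω => c * B (φ ⁻¹' {c}) ω := by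
  obtain rfl | hc := eq_or_ne c 0
  · filter_upwards [Lp.coeFn_zero ℝ 2 P] with ω hω
    rw [map_zero, hω, zero_mul, Pi.zero_apply]
  have hmeas := φ.measurableSet_preimage {c}
  have hfin := SimpleFunc.measure_preimage_lt_top_of_memLp two_ne_zero ENNReal.ofNat_ne_top φ hφ
    c hc
  rw [hB.toOperator_apply hmeas hfin]
  filter_upwards [Lp.coeFn_smul c ((hB.memLp hmeas hfin).toLp _),
    (hB.memLp hmeas hfin).coeFn_toLp] with ω hsmul htoLp
  rw [hsmul, Pi.smul_apply, htoLp, smul_eq_mul]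

theorem coeFn_setToSimpleFunc (hB : IsGaussianRandomMeasure B v P) {φ : SimpleFunc ℝ ℝ}
    (hφ : MemLp φ 2 volume) :
    ((φ.setToSimpleFunc hB.toOperator : Lp ℝ 2 P) : Ω → ℝ) =ᵐ[P] simpleIntegral B φ := by
  have hterm : ∀ᵐ ω ∂P, ∀ c ∈ φ.range,
      (hB.toOperator (φ ⁻¹' {c}) c) ω = c * B (φ ⁻¹' {c}) ω :=
    φ.range.finite_toSet.eventually_all.2 fun c _ => hB.coeFn_toOperator_preimage hφ c
  filter_upwards [hterm, Lp.coeFn_finsetSum φ.range fun c => hB.toOperator (φ ⁻¹' {c}) c]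
    with ω hterm hsum
  rw [SimpleFunc.setToSimpleFunc, hsum, Finset.sum_apply, simpleIntegral]
  exact Finset.sum_congr rfl hterm

theorem memLp_simpleIntegral (hB : IsGaussianRandomMeasure B v P) {φ : SimpleFunc ℝ ℝ}
    (hφ : MemLp φ 2 volume) : MemLp (simpleIntegral B φ) 2 P :=
  (Lp.memLp _).ae_eq (hB.coeFn_setToSimpleFunc hφ)

theorem simpleIntegral_add (hB : IsGaussianRandomMeasure B v P) {φ ψ : SimpleFunc ℝ ℝ}
    (hφ : MemLp φ 2 volume) (hψ : MemLp ψ 2 volume) :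
    simpleIntegral B (φ + ψ) =ᵐ[P] fun ω => simpleIntegral B φ ω + simpleIntegral B ψ ω := by
  have hint {χ : SimpleFunc ℝ ℝ} (h : MemLp χ 2 volume) : Integrable χ volume :=
    (SimpleFunc.memLp_iff_integrable two_ne_zero ENNReal.ofNat_ne_top).1 h
  have hadd := SimpleFunc.setToSimpleFunc_add _ hB.finMeasAdditive_toOperator (hint hφ) (hint hψ)
  filter_upwards [hB.coeFn_setToSimpleFunc (φ := φ + ψ) (hφ.add hψ), hB.coeFn_setToSimpleFunc hφ,
    hB.coeFn_setToSimpleFunc hψ, Lp.coeFn_add (φ.setToSimpleFunc hB.toOperator)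
      (ψ.setToSimpleFunc hB.toOperator)] with ω hφψ hφ hψ hcoe
  rw [← hφψ, hadd, hcoe, Pi.add_apply, hφ, hψ]

theorem simpleIntegral_smul (hB : IsGaussianRandomMeasure B v P) (c : ℝ) {φ : SimpleFunc ℝ ℝ}
    (hφ : MemLp φ 2 volume) :
    simpleIntegral B (c • φ) =ᵐ[P] fun ω => c * simpleIntegral B φ ω := by
  have hsmul := SimpleFunc.setToSimpleFunc_smul_real _ hB.finMeasAdditive_toOperator c
    ((SimpleFunc.memLp_iff_integrable two_ne_zero ENNReal.ofNat_ne_top).1 hφ)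
  filter_upwards [hB.coeFn_setToSimpleFunc (φ := c • φ) (hφ.const_smul c),
    hB.coeFn_setToSimpleFunc hφ, Lp.coeFn_smul c (φ.setToSimpleFunc hB.toOperator)]
    with ω hcφ hφ hcoe
  rw [← hcφ, hsmul, hcoe, Pi.smul_apply, hφ, smul_eq_mul]

theorem charFun_mul (hB : IsGaussianRandomMeasure B v P) {A : Set ℝ} (hA : MeasurableSet A)
    (hA' : volume A < ∞) (c θ : ℝ) :
    charFun (P.map fun ω => c * B A ω) θ =
      Complex.exp (-(v * (c ^ 2 * volume.real A) * θ ^ 2 / 2) : ℝ) := by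
  have hlaw := hB.hasLaw A hA hA'
  rw [charFun_map_mul_comp hlaw.aemeasurable, hlaw.map_eq, charFun_gaussianReal, measureReal_def,
    ← ENNReal.coe_toNNReal_eq_toReal]
  push_cast
  ring_nf

theorem charFun_simpleIntegral (hB : IsGaussianRandomMeasure B v P) {φ : SimpleFunc ℝ ℝ}
    (hφ : MemLp φ 2 volume) (θ : ℝ) :
    charFun (P.map (simpleIntegral B φ)) θ =
      Complex.exp (-(v * (∫ y, φ y ^ 2) * θ ^ 2 / 2) : ℝ) := by
  let S := φ.range.filter (· ≠ 0)
  have hmeas (c : S) : MeasurableSet (φ ⁻¹' {(c : ℝ)}) := φ.measurableSet_preimage _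
  have hfin (c : S) : volume (φ ⁻¹' {(c : ℝ)}) < ∞ :=
    SimpleFunc.measure_preimage_lt_top_of_memLp two_ne_zero ENNReal.ofNat_ne_top φ hφ c
      (Finset.mem_filter.1 c.2).2
  have hindep : iIndepFun (fun (c : S) ω => (c : ℝ) * B (φ ⁻¹' {(c : ℝ)}) ω) P :=
    (hB.iIndepFun_of_disjoint hmeas hfin fun c d hcd => (Set.disjoint_singleton.2
      (Subtype.coe_injective.ne hcd)).preimage φ).comp (fun c x => (c : ℝ) * x) fun _ =>
        measurable_const_mul _
  calc charFun (P.map (simpleIntegral B φ)) θ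
      = ∏ c : S, charFun (P.map fun ω => (c : ℝ) * B (φ ⁻¹' {(c : ℝ)}) ω) θ := by
        rw [simpleIntegral_eq_sum, hindep.charFun_map_fun_sum_eq_prod fun c =>
          (hB.memLp (hmeas c) (hfin c)).1.aemeasurable.const_mul _, Finset.prod_apply]
    _ = Complex.exp (-(v * (∫ y, φ y ^ 2) * θ ^ 2 / 2) : ℝ) := by
        simp_rw [hB.charFun_mul (hmeas _) (hfin _)]
        rw [← Complex.exp_sum, ← Complex.ofReal_sum, simpleFunc_integral_sq hφ, Finset.mul_sum,
          Finset.sum_mul, Finset.sum_div, Finset.sum_neg_distrib]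

theorem isWienerIntegral_simpleIntegral (hB : IsGaussianRandomMeasure B v P)
    {φ : SimpleFunc ℝ ℝ} (hφ : MemLp φ 2 volume) :
    IsWienerIntegral B P φ (simpleIntegral B φ) :=
  ⟨hφ, hB.memLp_simpleIntegral hφ, fun _ => φ, fun _ => hφ, by simp, by simp⟩

end IsGaussianRandomMeasure

namespace IsWienerIntegral

variable {f g : ℝ → ℝ} {X Y : Ω → ℝ}

theorem congr_ae (h : IsWienerIntegral B P f X) (hXY : X =ᵐ[P] Y) :
    IsWienerIntegral B P f Y := by
  obtain ⟨hf, hX, φ, hφ, hφf, hφX⟩ := h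
  exact ⟨hf, hX.ae_eq hXY, φ, hφ, hφf, hφX.congr fun m =>
    eLpNorm_congr_ae ((EventuallyEq.refl _ _).sub hXY)⟩

theorem add (hX : IsWienerIntegral B P f X) (hY : IsWienerIntegral B P g Y)
    (hB : IsGaussianRandomMeasure B v P) :
    IsWienerIntegral B P (fun y => f y + g y) fun ω => X ω + Y ω := by
  obtain ⟨hf, hX, φ, hφ, hφf, hφX⟩ := hX
  obtain ⟨hg, hY, ψ, hψ, hψg, hψY⟩ := hY
  refine ⟨hf.add hg, hX.add hY, fun m => φ m + ψ m, fun m => (hφ m).add (hψ m),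
    tendsto_of_tendsto_of_tendsto_of_le_of_le tendsto_const_nhds
      (by simpa only [add_zero] using hφf.add hψg) (fun _ => zero_le) fun m => ?_,
    tendsto_of_tendsto_of_tendsto_of_le_of_le tendsto_const_nhds
      (by simpa only [add_zero] using hφX.add hψY) (fun _ => zero_le) fun m => ?_⟩
  · have hsplit : (fun y => (φ m + ψ m) y - (f y + g y)) =
        (fun y => φ m y - f y) + fun y => ψ m y - g y := funext fun y => add_sub_add_comm _ _ _ _
    rw [hsplit]
    exact eLpNorm_add_le ((hφ m).1.sub hf.1) ((hψ m).1.sub hg.1) one_le_two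
  · have hsplit : (fun ω => simpleIntegral B (φ m + ψ m) ω - (X ω + Y ω)) =ᵐ[P]
        (fun ω => simpleIntegral B (φ m) ω - X ω) + fun ω => simpleIntegral B (ψ m) ω - Y ω := by
      filter_upwards [hB.simpleIntegral_add (hφ m) (hψ m)] with ω hω
      rw [hω, Pi.add_apply, add_sub_add_comm]
    rw [eLpNorm_congr_ae hsplit]
    exact eLpNorm_add_le ((hB.memLp_simpleIntegral (hφ m)).1.sub hX.1)
      ((hB.memLp_simpleIntegral (hψ m)).1.sub hY.1) one_le_two

theorem const_mul (hX : IsWienerIntegral B P f X) (hB : IsGaussianRandomMeasure B v P) (c : ℝ) :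
    IsWienerIntegral B P (fun y => c * f y) fun ω => c * X ω := by
  obtain ⟨hf, hX, φ, hφ, hφf, hφX⟩ := hX
  refine ⟨hf.const_mul c, hX.const_mul c, fun m => c • φ m, fun m => (hφ m).const_smul c, ?_, ?_⟩
  · have hsplit (m : ℕ) : (fun y => (c • φ m) y - c * f y) = c • fun y => φ m y - f y :=
      funext fun y => (mul_sub _ _ _).symm
    simp only [hsplit, eLpNorm_const_smul]
    simpa only [mul_zero] using ENNReal.Tendsto.const_mul hφf (Or.inr enorm_ne_top)
  · have hsplit (m : ℕ) : (fun ω => simpleIntegral B (c • φ m) ω - c * X ω) =ᵐ[P]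
        c • fun ω => simpleIntegral B (φ m) ω - X ω := by
      filter_upwards [hB.simpleIntegral_smul c (hφ m)] with ω hω
      rw [hω, Pi.smul_apply, smul_eq_mul, mul_sub]
    simp only [eLpNorm_congr_ae (hsplit _), eLpNorm_const_smul]
    simpa only [mul_zero] using ENNReal.Tendsto.const_mul hφX (Or.inr enorm_ne_top)

theorem sub (hX : IsWienerIntegral B P f X) (hY : IsWienerIntegral B P g Y)
    (hB : IsGaussianRandomMeasure B v P) :
    IsWienerIntegral B P (fun y => f y - g y) fun ω => X ω - Y ω := by
  simpa only [neg_one_mul, ← sub_eq_add_neg] using hX.add (hY.const_mul hB (-1)) hB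

theorem zero (B : Set ℝ → Ω → ℝ) (P : Measure Ω) :
    IsWienerIntegral B P (fun _ => 0) fun _ => 0 := by
  have hI : simpleIntegral B 0 = fun _ : Ω => (0 : ℝ) := by
    funext ω
    refine Finset.sum_eq_zero fun c hc => ?_
    obtain ⟨x, rfl⟩ := SimpleFunc.mem_range.1 hc
    exact zero_mul _
  exact ⟨MemLp.zero', MemLp.zero', fun _ => 0, fun _ => MemLp.zero, by simp, by simp [hI]⟩

theorem finsetSum (hB : IsGaussianRandomMeasure B v P) {ι : Type*} (s : Finset ι) (a : ι → ℝ)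
    {f : ι → ℝ → ℝ} {X : ι → Ω → ℝ} (h : ∀ i, IsWienerIntegral B P (f i) (X i)) :
    IsWienerIntegral B P (fun y => ∑ i ∈ s, a i * f i y) fun ω => ∑ i ∈ s, a i * X i ω := by
  classical
  induction s using Finset.induction_on with
  | empty => simpa only [Finset.sum_empty] using zero B P
  | insert i s hi ih =>
    simp only [Finset.sum_insert hi]
    exact ((h i).const_mul hB (a i)).add ih hB

variable [IsProbabilityMeasure P]

theorem hasLaw (h : IsWienerIntegral B P f X) (hB : IsGaussianRandomMeasure B v P) :
    HasLaw X (gaussianReal 0 (v * (∫ y, f y ^ 2).toNNReal)) P := by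
  obtain ⟨hf, hX, φ, hφ, hφf, hφX⟩ := h
  refine hasLaw_gaussianReal_of_charFun hX.1.aemeasurable fun θ => ?_
  have hI (m : ℕ) := hB.memLp_simpleIntegral (hφ m)
  have hlaw : TendstoInDistribution (fun m => simpleIntegral B (φ m)) atTop X (fun _ => P) P :=
    (tendstoInMeasure_of_tendsto_eLpNorm two_ne_zero (fun m => (hI m).1) hX.1
      hφX).tendstoInDistribution fun m => (hI m).1.aemeasurable
  have hchar := ProbabilityMeasure.tendsto_iff_tendsto_charFun.1 hlaw.tendsto θ
  simp only [ProbabilityMeasure.coe_mk, hB.charFun_simpleIntegral (hφ _)] at hchar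
  refine tendsto_nhds_unique hchar ?_
  rw [NNReal.coe_mul, Real.coe_toNNReal _ (integral_nonneg fun _ => sq_nonneg _)]
  exact ((by fun_prop : Continuous fun x : ℝ =>
    Complex.exp (-(v * x * θ ^ 2 / 2) : ℝ)).tendsto _).comp (tendsto_integral_sq hφ hf hφf)

theorem lintegral_sq (h : IsWienerIntegral B P f X) (hB : IsGaussianRandomMeasure B v P) :
    ∫⁻ ω, ‖X ω‖ₑ ^ 2 ∂P = v * ∫⁻ y, ‖f y‖ₑ ^ 2 := by
  rw [lintegral_enorm_sq_eq_ofReal h.2.1, integral_sq_of_hasLaw_gaussianReal (h.hasLaw hB),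
    lintegral_enorm_sq_eq_ofReal h.1, ENNReal.ofReal_coe_nnreal, ENNReal.coe_mul]
  rfl

theorem integral_exp (h : IsWienerIntegral B P f X) (hB : IsGaussianRandomMeasure B v P) :
    ∫ ω, Complex.exp (X ω * Complex.I) ∂P = Complex.exp (-(v * (∫ y, f y ^ 2) / 2) : ℝ) := by
  have hlaw := h.hasLaw hB
  have hchar : charFun (P.map X) 1 = ∫ ω, Complex.exp (X ω * Complex.I) ∂P := by
    rw [charFun_apply_real, integral_map hlaw.aemeasurable (by fun_prop)]
    simp only [Complex.ofReal_one, one_mul]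
  rw [← hchar, hlaw.map_eq, charFun_gaussianReal, NNReal.coe_mul,
    Real.coe_toNNReal _ (integral_nonneg fun _ => sq_nonneg _)]
  push_cast
  ring_nf

theorem eLpNorm_eq (h : IsWienerIntegral B P f X) (hB : IsGaussianRandomMeasure B v P) :
    eLpNorm X 2 P = NNReal.sqrt v * eLpNorm f 2 volume := by
  refine (ENNReal.pow_right_strictMono two_ne_zero).injective ?_
  rw [mul_pow, sq_eLpNorm_two, sq_eLpNorm_two, h.lintegral_sq hB, ← ENNReal.coe_pow,
    NNReal.sq_sqrt]

end IsWienerIntegral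

theorem exists_tendsto_simpleFunc {f : ℝ → ℝ} (hf : MemLp f 2 volume) :
    ∃ φ : ℕ → SimpleFunc ℝ ℝ, (∀ m, MemLp (φ m) 2 volume) ∧
      Tendsto (fun m => eLpNorm (fun y => φ m y - f y) 2 volume) atTop (𝓝 0) := by
  choose φ hφ hφm using fun m : ℕ => hf.exists_simpleFunc_eLpNorm_sub_lt ENNReal.ofNat_ne_top
    (ε := ((m : ℝ≥0∞) + 1)⁻¹) (by simp)
  refine ⟨φ, hφm, tendsto_of_tendsto_of_tendsto_of_le_of_le tendsto_const_nhds
    (ENNReal.tendsto_inv_nat_nhds_zero.comp (tendsto_add_atTop_nat 1)) (fun _ => zero_le)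
    fun m => ?_⟩
  have h := (hφ m).le
  rw [eLpNorm_sub_comm] at h
  simpa only [Function.comp_apply, Nat.cast_add, Nat.cast_one, Pi.sub_def] using h

theorem IsGaussianRandomMeasure.exists_isWienerIntegral [IsProbabilityMeasure P]
    (hB : IsGaussianRandomMeasure B v P) {f : ℝ → ℝ} (hf : MemLp f 2 volume) :
    ∃ X, IsWienerIntegral B P f X := by
  obtain ⟨φ, hφ, hφf⟩ := exists_tendsto_simpleFunc hf
  have hI (m : ℕ) := hB.memLp_simpleIntegral (hφ m)
  have hisometry (n m : ℕ) : dist ((hI n).toLp _) ((hI m).toLp _) =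
      NNReal.sqrt v * dist ((hφ n).toLp _) ((hφ m).toLp _) := by
    rw [Lp.dist_edist, Lp.dist_edist, Lp.edist_toLp_toLp, Lp.edist_toLp_toLp]
    have h := ((hB.isWienerIntegral_simpleIntegral (hφ n)).sub
      (hB.isWienerIntegral_simpleIntegral (hφ m)) hB).eLpNorm_eq hB
    exact (congrArg ENNReal.toReal h).trans ENNReal.toReal_mul
  have hφcauchy : CauchySeq fun m => (hφ m).toLp (φ m) :=
    ((Lp.tendsto_Lp_iff_tendsto_eLpNorm'' _ hφ f hf).2 hφf).cauchySeq
  have hcauchy : CauchySeq fun m => (hI m).toLp (simpleIntegral B (φ m)) := by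
    obtain ⟨b, -, hφb, hb0⟩ := cauchySeq_iff_le_tendsto_0.1 hφcauchy
    refine cauchySeq_of_le_tendsto_0 (fun N => NNReal.sqrt v * b N) (fun n m N hn hm => ?_)
      (by simpa only [mul_zero] using hb0.const_mul (NNReal.sqrt v : ℝ))
    rw [hisometry]
    exact mul_le_mul_of_nonneg_left (hφb n m N hn hm) (NNReal.coe_nonneg _)
  obtain ⟨X, hX⟩ := cauchySeq_tendsto_of_complete hcauchy
  refine ⟨X, hf, Lp.memLp X, φ, hφ, hφf, ?_⟩
  refine (Lp.tendsto_Lp_iff_tendsto_eLpNorm'' _ hI X (Lp.memLp X)).1 ?_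
  rwa [Lp.toLp_coeFn]

end Wiener

/-! ### Power kernels -/

section PowerKernel

theorem temperedPower_of_pos (p lam : ℝ) {x : ℝ} (hx : 0 < x) :
    temperedPower p lam x = x ^ p * Real.exp (-(lam * x)) :=
  if_pos hx

theorem temperedPower_of_nonpos (p lam : ℝ) {x : ℝ} (hx : x ≤ 0) : temperedPower p lam x = 0 :=
  if_neg hx.not_gt

theorem temperedPower_zero_of_pos (p : ℝ) {x : ℝ} (hx : 0 < x) : temperedPower p 0 x = x ^ p := by
  rw [temperedPower_of_pos p 0 hx, zero_mul, neg_zero, Real.exp_zero, mul_one]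

theorem temperedPower_nonneg (p lam x : ℝ) : 0 ≤ temperedPower p lam x := by
  unfold temperedPower
  split_ifs <;> positivity

theorem measurable_temperedPower (p lam : ℝ) : Measurable (temperedPower p lam) :=
  Measurable.ite measurableSet_Ioi (by fun_prop) measurable_const

theorem rpow_mul_exp_neg_le {s lam u : ℝ} (hs : 0 ≤ s) (hlam : 0 < lam) (hu : 0 ≤ u) :
    u ^ s * Real.exp (-(lam * u)) ≤ (s / lam) ^ s := by
  rcases hs.eq_or_lt with rfl | hs
  · simpa using mul_nonneg hlam.le hu
  have hexp : (lam * u / s) ^ s ≤ Real.exp (lam * u) := by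
    calc (lam * u / s) ^ s ≤ Real.exp (lam * u / s) ^ s := by
          gcongr
          linarith [Real.add_one_le_exp (lam * u / s)]
      _ = Real.exp (lam * u) := by rw [← Real.exp_mul, div_mul_cancel₀ _ hs.ne']
  calc u ^ s * Real.exp (-(lam * u))
      = (s / lam) ^ s * (lam * u / s) ^ s * Real.exp (-(lam * u)) := by
        rw [← Real.mul_rpow (by positivity) (by positivity)]
        congr 2
        field_simp
    _ ≤ (s / lam) ^ s * Real.exp (lam * u) * Real.exp (-(lam * u)) := by gcongr
    _ = (s / lam) ^ s := by rw [mul_assoc, ← Real.exp_add, add_neg_cancel, Real.exp_zero, mul_one]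

theorem exists_temperedPower_le {p q lam : ℝ} (hqp : q ≤ p) (hq : q ≤ 0) (hlam : 0 < lam) :
    ∃ K : ℝ≥0, ∀ u x : ℝ, (0 < u → 0 < x ∧ x / 2 ≤ u) →
      temperedPower p lam u ≤ K * temperedPower q 0 x := by
  have hs : 0 ≤ p - q := sub_nonneg.2 hqp
  refine ⟨⟨((p - q) / lam) ^ (p - q) * (1 / 2) ^ q, by positivity⟩, fun u x h => ?_⟩
  rcases le_or_gt u 0 with hu | hu
  · rw [temperedPower_of_nonpos _ _ hu]
    exact mul_nonneg (NNReal.coe_nonneg _) (temperedPower_nonneg _ _ _)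
  obtain ⟨hx, hxu⟩ := h hu
  rw [temperedPower_zero_of_pos _ hx, temperedPower_of_pos _ _ hu]
  calc u ^ p * Real.exp (-(lam * u))
      = u ^ (p - q) * Real.exp (-(lam * u)) * u ^ q := by
        rw [mul_right_comm, ← Real.rpow_add hu, sub_add_cancel]
    _ ≤ ((p - q) / lam) ^ (p - q) * (x / 2) ^ q :=
        mul_le_mul (rpow_mul_exp_neg_le hs hlam hu.le)
          (Real.rpow_le_rpow_of_nonpos (by positivity) hxu hq) (by positivity) (by positivity)
    _ = ((p - q) / lam) ^ (p - q) * (1 / 2) ^ q * x ^ q := by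
        rw [mul_assoc, ← Real.mul_rpow (by norm_num) hx.le, one_div_mul_eq_div]

/-- The antiderivative `(x)_+^β / β` of `(x)_+^(β-1)` that vanishes at `0`, for `β > 0`. -/
noncomputable def posPower (β x : ℝ) : ℝ := (max x 0) ^ β / β

theorem measurable_posPower (β : ℝ) : Measurable (posPower β) := by
  unfold posPower
  fun_prop

variable {β : ℝ}

theorem posPower_of_nonpos (hβ : 0 < β) {x : ℝ} (hx : x ≤ 0) : posPower β x = 0 := by
  rw [posPower, max_eq_right hx, Real.zero_rpow hβ.ne', zero_div]

theorem monotone_posPower (hβ : 0 < β) : Monotone (posPower β) := by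
  intro x y h
  unfold posPower
  gcongr

theorem intervalIntegrable_power (hβ : 0 < β) (a b : ℝ) :
    IntervalIntegrable (temperedPower (β - 1) 0) volume a b := by
  have h : IntervalIntegrable (fun x : ℝ => x ^ (β - 1)) volume a b :=
    intervalIntegral.intervalIntegrable_rpow' (by linarith)
  refine h.mono_fun (measurable_temperedPower _ _).aestronglyMeasurable (ae_of_all _ fun x => ?_)
  beta_reduce
  rcases le_or_gt x 0 with hx | hx
  · rw [temperedPower_of_nonpos _ _ hx, norm_zero]
    exact norm_nonneg _
  · rw [temperedPower_zero_of_pos _ hx]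

theorem intervalIntegrable_power_sub (hβ : 0 < β) (a b y : ℝ) :
    IntervalIntegrable (fun s => temperedPower (β - 1) 0 (s - y)) volume a b := by
  simpa using (intervalIntegrable_power hβ (a - y) (b - y)).comp_sub_right y

theorem integral_zero_power (hβ : 0 < β) (x : ℝ) :
    ∫ s in (0 : ℝ)..x, temperedPower (β - 1) 0 s = posPower β x := by
  rcases le_or_gt x 0 with hx | hx
  · rw [posPower_of_nonpos hβ hx]
    refine intervalIntegral.integral_zero_ae (ae_of_all _ fun s hs => ?_)
    rw [Set.uIoc_of_ge hx] at hs
    exact temperedPower_of_nonpos _ _ hs.2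
  · calc ∫ s in (0 : ℝ)..x, temperedPower (β - 1) 0 s
        = ∫ s in (0 : ℝ)..x, s ^ (β - 1) := by
          refine intervalIntegral.integral_congr_ae (ae_of_all _ fun s hs => ?_)
          rw [Set.uIoc_of_le hx.le] at hs
          exact temperedPower_zero_of_pos _ hs.1
      _ = posPower β x := by
          rw [integral_rpow (Or.inl (by linarith)), sub_add_cancel, Real.zero_rpow hβ.ne',
            sub_zero, posPower, max_eq_left hx.le]

theorem integral_power_sub (hβ : 0 < β) (a b y : ℝ) :
    ∫ s in a..b, temperedPower (β - 1) 0 (s - y) = posPower β (b - y) - posPower β (a - y) := by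
  rw [intervalIntegral.integral_comp_sub_right (fun s => temperedPower (β - 1) 0 s),
    ← integral_zero_power hβ, ← integral_zero_power hβ,
    intervalIntegral.integral_interval_sub_left (intervalIntegrable_power hβ _ _)
      (intervalIntegrable_power hβ _ _)]

theorem posPower_add_sub_le (hβ : 0 < β) (hβ1 : β ≤ 1) {h : ℝ} (hh : 0 ≤ h) (x : ℝ) :
    posPower β (h + x) - posPower β x ≤ h ^ β / β := by
  unfold posPower
  rw [← sub_div]
  gcongr
  rw [sub_le_iff_le_add']
  calc (max (h + x) 0) ^ β ≤ (max x 0 + h) ^ β := by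
        refine Real.rpow_le_rpow (le_max_right _ _) (max_le ?_ (by positivity)) hβ.le
        linarith [le_max_left x 0]
    _ ≤ (max x 0) ^ β + h ^ β := Real.rpow_add_le_add_rpow (le_max_right x 0) hh hβ.le hβ1

theorem posPower_add_sub_le_of_pos (hβ : 0 < β) (hβ1 : β ≤ 1) {h x : ℝ} (hh : 0 ≤ h)
    (hx : 0 < x) : posPower β (h + x) - posPower β x ≤ h * x ^ (β - 1) := by
  have bernoulli : (1 + h / x) ^ β ≤ 1 + β * (h / x) :=
    rpow_one_add_le_one_add_mul_self (by linarith [div_nonneg hh hx.le]) hβ.le hβ1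
  unfold posPower
  rw [max_eq_left hx.le, max_eq_left (by positivity), ← sub_div, div_le_iff₀ hβ, sub_le_iff_le_add']
  calc (h + x) ^ β = x ^ β * (1 + h / x) ^ β := by
        rw [← Real.mul_rpow hx.le (by positivity), mul_add, mul_one, mul_div_cancel₀ _ hx.ne',
          add_comm]
    _ ≤ x ^ β * (1 + β * (h / x)) := by gcongr
    _ = x ^ β + h * x ^ (β - 1) * β := by
        rw [Real.rpow_sub_one hx.ne']
        ring

theorem enorm_posPower_add_sub_sq_le (hβ : 0 < β) (hβ1 : β ≤ 1) {h : ℝ} (hh : 0 < h) (x : ℝ) :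
    ‖posPower β (h + x) - posPower β x‖ₑ ^ 2 ≤
      (Set.Ioc (-h) h).indicator (fun _ => ENNReal.ofReal ((h ^ β / β) ^ 2)) x +
      (Set.Ioi h).indicator (fun x => ENNReal.ofReal (h ^ 2 * x ^ (2 * β - 2))) x := by
  have hnn : 0 ≤ posPower β (h + x) - posPower β x :=
    sub_nonneg.2 (monotone_posPower hβ (by linarith))
  rw [Real.enorm_of_nonneg hnn, ← ENNReal.ofReal_pow hnn]
  rcases le_or_gt x (-h) with hx | hx
  · rw [posPower_of_nonpos hβ (by linarith), posPower_of_nonpos hβ (by linarith)]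
    simp
  rcases le_or_gt x h with hxh | hxh
  · rw [Set.indicator_of_mem (s := Set.Ioc (-h) h) ⟨hx, hxh⟩]
    refine le_add_right (ENNReal.ofReal_le_ofReal ?_)
    exact pow_le_pow_left₀ hnn (posPower_add_sub_le hβ hβ1 hh.le x) 2
  · have hx0 : 0 < x := hh.trans hxh
    rw [Set.indicator_of_mem (s := Set.Ioi h) hxh]
    refine le_add_left (ENNReal.ofReal_le_ofReal ?_)
    calc (posPower β (h + x) - posPower β x) ^ 2 ≤ (h * x ^ (β - 1)) ^ 2 :=
          pow_le_pow_left₀ hnn (posPower_add_sub_le_of_pos hβ hβ1 hh.le hx0) 2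
      _ = h ^ 2 * x ^ (2 * β - 2) := by
          rw [mul_pow, ← Real.rpow_mul_natCast hx0.le]
          congr 2
          push_cast
          ring

theorem sq_mul_rpow {h : ℝ} (hh : 0 < h) (p : ℝ) : h ^ 2 * h ^ p = h ^ (2 + p) := by
  rw [Real.rpow_add hh, Real.rpow_two]

theorem lintegral_Ioi_sq_mul_rpow (hβ1 : β < 1 / 2) {h : ℝ} (hh : 0 < h) :
    ∫⁻ x in Set.Ioi h, ENNReal.ofReal (h ^ 2 * x ^ (2 * β - 2)) =
      ENNReal.ofReal (h ^ (1 + 2 * β) / (1 - 2 * β)) := by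
  rw [← ofReal_integral_eq_lintegral_ofReal
      ((integrableOn_Ioi_rpow_of_lt (by linarith) hh).const_mul _)
      (ae_restrict_of_forall_mem measurableSet_Ioi fun x hx =>
        mul_nonneg (sq_nonneg _) (Real.rpow_nonneg (hh.trans hx).le _)),
    integral_const_mul, integral_Ioi_rpow_of_lt (by linarith) hh]
  congr 1
  rw [neg_div, ← div_neg, mul_div_assoc', sq_mul_rpow hh]
  congr 1
  · congr 1
    ring
  · ring

theorem lintegral_posPower_add_sub_le (hβ : 0 < β) (hβ1 : β < 1 / 2) {h : ℝ} (hh : 0 < h) :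
    ∫⁻ x, ‖posPower β (h + x) - posPower β x‖ₑ ^ 2 ≤
      ENNReal.ofReal ((2 / β ^ 2 + 1 / (1 - 2 * β)) * h ^ (1 + 2 * β)) := by
  have hpos : 0 < 1 - 2 * β := by linarith
  calc ∫⁻ x, ‖posPower β (h + x) - posPower β x‖ₑ ^ 2
      ≤ ∫⁻ x, ((Set.Ioc (-h) h).indicator (fun _ => ENNReal.ofReal ((h ^ β / β) ^ 2)) x +
          (Set.Ioi h).indicator (fun x => ENNReal.ofReal (h ^ 2 * x ^ (2 * β - 2))) x) :=
        lintegral_mono (enorm_posPower_add_sub_sq_le hβ (by linarith) hh)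
    _ = ENNReal.ofReal ((h ^ β / β) ^ 2 * (h - -h) + h ^ (1 + 2 * β) / (1 - 2 * β)) := by
        rw [lintegral_add_left (measurable_const.indicator measurableSet_Ioc),
          lintegral_indicator_const measurableSet_Ioc, lintegral_indicator measurableSet_Ioi,
          Real.volume_Ioc, ← ENNReal.ofReal_mul (by positivity), lintegral_Ioi_sq_mul_rpow hβ1 hh,
          ← ENNReal.ofReal_add (mul_nonneg (sq_nonneg _) (by linarith)) (by positivity)]
    _ = _ := by
        have hsq : h ^ (1 + 2 * β) = h * (h ^ β) ^ 2 := by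
          rw [Real.rpow_add hh, Real.rpow_one, ← Real.rpow_mul_natCast hh.le, mul_comm β]
          norm_num
        rw [hsq]
        congr 1
        field_simp
        ring

theorem exists_lintegral_posPower_sub_le (hβ : 0 < β) (hβ1 : β < 1 / 2) :
    ∃ c : ℝ≥0, ∀ a b : ℝ, a ≤ b →
      ∫⁻ y, ‖posPower β (b - y) - posPower β (a - y)‖ₑ ^ 2 ≤
        ENNReal.ofReal (c * (b - a) ^ (1 + 2 * β)) := by
  have hpos : 0 < 1 - 2 * β := by linarith
  refine ⟨⟨2 / β ^ 2 + 1 / (1 - 2 * β), by positivity⟩, fun a b hab => ?_⟩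
  rcases hab.eq_or_lt with rfl | hlt
  · simp
  calc ∫⁻ y, ‖posPower β (b - y) - posPower β (a - y)‖ₑ ^ 2
      = ∫⁻ y, ‖posPower β (b - a + (a - y)) - posPower β (a - y)‖ₑ ^ 2 := by
        simp only [sub_add_sub_cancel]
    _ = ∫⁻ x, ‖posPower β (b - a + x) - posPower β x‖ₑ ^ 2 :=
        lintegral_sub_left_eq_self
          (fun x => ‖posPower β (b - a + x) - posPower β x‖ₑ ^ 2) a
    _ ≤ _ := lintegral_posPower_add_sub_le hβ hβ1 (sub_pos.2 hlt)

/-- The kernel `a` is measurable in its first argument and dominated by the multiple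
`K (s - y)_+^(β-1)` of the power kernel. Both the kernel of the tempered Hermite process and its
discretizations are of this kind, with common constants. -/
structure PowerBound (β : ℝ) (K : ℝ≥0) (a : ℝ → ℝ → ℝ) : Prop where
  measurable : ∀ y, Measurable fun s => a s y
  bound : ∀ s y, |a s y| ≤ K * temperedPower (β - 1) 0 (s - y)

namespace PowerBound

variable {K : ℝ≥0} {a : ℝ → ℝ → ℝ}

theorem intervalIntegrable (h : PowerBound β K a) (hβ : 0 < β) (t₁ t₂ y : ℝ) :
    IntervalIntegrable (fun s => a s y) volume t₁ t₂ :=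
  ((intervalIntegrable_power_sub hβ t₁ t₂ y).const_mul (K : ℝ)).mono_fun
    (h.measurable y).aestronglyMeasurable
    (ae_of_all _ fun s => (h.bound s y).trans (le_abs_self _))

theorem abs_integral_le (h : PowerBound β K a) (hβ : 0 < β) {t₁ t₂ : ℝ} (ht : t₁ ≤ t₂) (y : ℝ) :
    |∫ s in t₁..t₂, a s y| ≤ K * (posPower β (t₂ - y) - posPower β (t₁ - y)) := by
  rw [← integral_power_sub hβ, ← intervalIntegral.integral_const_mul]
  exact intervalIntegral.norm_integral_le_of_norm_le (f := fun s => a s y) ht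
    (ae_of_all _ fun s _ => h.bound s y)
    ((intervalIntegrable_power_sub hβ _ _ _).const_mul (K : ℝ))

theorem abs_integral_zero_le (h : PowerBound β K a) (hβ : 0 < β) (hβ1 : β ≤ 1) {t : ℝ}
    (ht : 0 ≤ t) (y : ℝ) : |∫ s in (0 : ℝ)..t, a s y| ≤ K * (t ^ β / β) := by
  have hinc : posPower β (t - y) - posPower β (0 - y) ≤ t ^ β / β := by
    rw [sub_eq_add_neg t, zero_sub]
    exact posPower_add_sub_le hβ hβ1 ht (-y)
  exact (h.abs_integral_le hβ ht y).trans (by gcongr)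

theorem integral_sub (h : PowerBound β K a) (hβ : 0 < β) (t₁ t₂ y : ℝ) :
    (∫ s in (0 : ℝ)..t₂, a s y) - ∫ s in (0 : ℝ)..t₁, a s y = ∫ s in t₁..t₂, a s y :=
  intervalIntegral.integral_interval_sub_left (h.intervalIntegrable hβ _ _ _)
    (h.intervalIntegrable hβ _ _ _)

theorem enorm_integral_sub_le (h : PowerBound β K a) (hβ : 0 < β) {t₁ t₂ : ℝ} (ht : t₁ ≤ t₂)
    (y : ℝ) : ‖(∫ s in (0 : ℝ)..t₂, a s y) - ∫ s in (0 : ℝ)..t₁, a s y‖ₑ ≤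
      K * ‖posPower β (t₂ - y) - posPower β (t₁ - y)‖ₑ := by
  rw [h.integral_sub hβ, Real.enorm_eq_ofReal_abs, Real.enorm_of_nonneg
    (sub_nonneg.2 (monotone_posPower hβ (by linarith))), ← ENNReal.ofReal_coe_nnreal,
    ← ENNReal.ofReal_mul K.coe_nonneg]
  exact ENNReal.ofReal_le_ofReal (h.abs_integral_le hβ ht y)

end PowerBound

theorem exists_lintegral_increment_le (hβ : 0 < β) (hβ1 : β < 1 / 2) (K : ℝ≥0) :
    ∃ c : ℝ≥0, ∀ a : ℝ → ℝ → ℝ, PowerBound β K a → ∀ t₁ t₂ : ℝ,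
      ∫⁻ y, ‖(∫ s in (0 : ℝ)..t₂, a s y) - ∫ s in (0 : ℝ)..t₁, a s y‖ₑ ^ 2 ≤
        ENNReal.ofReal (c * |t₂ - t₁| ^ (1 + 2 * β)) := by
  obtain ⟨c, hc⟩ := exists_lintegral_posPower_sub_le hβ hβ1
  refine ⟨K ^ 2 * c, fun a ha t₁ t₂ => ?_⟩
  wlog ht : t₁ ≤ t₂ generalizing t₁ t₂
  · simp only [abs_sub_comm t₂, enorm_sub_rev (∫ _ in (0 : ℝ)..t₂, _)]
    exact this t₂ t₁ (le_of_not_ge ht)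
  calc ∫⁻ y, ‖(∫ s in (0 : ℝ)..t₂, a s y) - ∫ s in (0 : ℝ)..t₁, a s y‖ₑ ^ 2
      ≤ ∫⁻ y, (K : ℝ≥0∞) ^ 2 * ‖posPower β (t₂ - y) - posPower β (t₁ - y)‖ₑ ^ 2 := by
        refine lintegral_mono fun y => ?_
        rw [← mul_pow]
        exact pow_le_pow_left' (ha.enorm_integral_sub_le hβ ht y) 2
    _ = (K : ℝ≥0∞) ^ 2 * ∫⁻ y, ‖posPower β (t₂ - y) - posPower β (t₁ - y)‖ₑ ^ 2 :=
        lintegral_const_mul' _ _ (ENNReal.pow_ne_top ENNReal.coe_ne_top)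
    _ ≤ (K : ℝ≥0∞) ^ 2 * ENNReal.ofReal (c * (t₂ - t₁) ^ (1 + 2 * β)) := by
        gcongr
        exact hc t₁ t₂ ht
    _ = ENNReal.ofReal ((K ^ 2 * c : ℝ≥0) * |t₂ - t₁| ^ (1 + 2 * β)) := by
        rw [abs_of_nonneg (sub_nonneg.2 ht), NNReal.coe_mul, NNReal.coe_pow, mul_assoc,
          ENNReal.ofReal_mul (sq_nonneg (K : ℝ)), ENNReal.ofReal_pow K.coe_nonneg,
          ENNReal.ofReal_coe_nnreal]

end PowerKernel

/-! ### Discretized kernels -/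

section Grid

/-- The distance, with sign, from the grid point `j / n` to the grid point that follows `s`, i.e.
the smallest `k / n` with `s ≤ k / n`. -/
noncomputable def gridDist (n : ℕ) (s : ℝ) (j : ℤ) : ℝ := ((⌈(n : ℝ) * s⌉ - j : ℤ) : ℝ) / n

theorem gridDist_nonpos (n : ℕ) {s y : ℝ} (h : s ≤ y) : gridDist n s ⌈(n : ℝ) * y⌉ ≤ 0 := by
  refine div_nonpos_of_nonpos_of_nonneg (Int.cast_nonpos.2 (sub_nonpos.2 ?_)) n.cast_nonneg
  gcongr

theorem half_sub_le_gridDist {n : ℕ} (hn : 0 < n) {s y : ℝ}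
    (h : 0 < gridDist n s ⌈(n : ℝ) * y⌉) : (s - y) / 2 ≤ gridDist n s ⌈(n : ℝ) * y⌉ := by
  have hn' : (0 : ℝ) < n := Nat.cast_pos.2 hn
  have hone : (1 : ℝ) ≤ ⌈(n : ℝ) * s⌉ - ⌈(n : ℝ) * y⌉ := by
    exact_mod_cast Int.add_one_le_of_lt (Int.cast_pos.1 ((div_pos_iff_of_pos_right hn').1 h))
  rw [gridDist, le_div_iff₀ hn']
  push_cast
  linarith [Int.le_ceil ((n : ℝ) * s), Int.ceil_lt_add_one ((n : ℝ) * y)]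

theorem tendsto_ceil_natCast_mul_div (x : ℝ) :
    Tendsto (fun n : ℕ => (⌈(n : ℝ) * x⌉ : ℝ) / n) atTop (𝓝 x) := by
  have hupper : Tendsto (fun n : ℕ => x + 1 / (n : ℝ)) atTop (𝓝 x) := by
    simpa using tendsto_one_div_atTop_nhds_zero_nat.const_add x
  refine tendsto_of_tendsto_of_tendsto_of_le_of_le' tendsto_const_nhds hupper ?_ ?_
  all_goals
    filter_upwards [eventually_gt_atTop 0] with n hn
    have hn' : (0 : ℝ) < n := Nat.cast_pos.2 hn
  · rw [le_div_iff₀ hn', mul_comm]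
    exact Int.le_ceil _
  · rw [div_le_iff₀ hn', add_mul, one_div_mul_cancel hn'.ne', mul_comm x]
    exact (Int.ceil_lt_add_one _).le

theorem tendsto_gridDist (s y : ℝ) :
    Tendsto (fun n : ℕ => gridDist n s ⌈(n : ℝ) * y⌉) atTop (𝓝 (s - y)) := by
  refine ((tendsto_ceil_natCast_mul_div s).sub (tendsto_ceil_natCast_mul_div y)).congr fun n => ?_
  rw [gridDist, Int.cast_sub, sub_div]

theorem continuousAt_temperedPower (p lam : ℝ) {x : ℝ} (hx : 0 < x) :
    ContinuousAt (temperedPower p lam) x := by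
  have h : ContinuousAt (fun x : ℝ => x ^ p * Real.exp (-(lam * x))) x :=
    (Real.continuousAt_rpow_const _ _ (Or.inl hx.ne')).mul (by fun_prop)
  refine h.congr ?_
  filter_upwards [lt_mem_nhds hx] with y hy
  rw [temperedPower_of_pos _ _ hy]

theorem tendsto_temperedPower_gridDist (p lam s y : ℝ) :
    Tendsto (fun n : ℕ => temperedPower p lam (gridDist n s ⌈(n : ℝ) * y⌉)) atTop
      (𝓝 (temperedPower p lam (s - y))) := by
  rcases le_or_gt s y with h | h
  · rw [temperedPower_of_nonpos _ _ (sub_nonpos.2 h)]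
    exact tendsto_const_nhds.congr fun n =>
      (temperedPower_of_nonpos _ _ (gridDist_nonpos n h)).symm
  · exact (continuousAt_temperedPower p lam (sub_pos.2 h)).tendsto.comp (tendsto_gridDist s y)

theorem measurable_comp_ceil {E : Type*} [MeasurableSpace E] (n : ℕ) (f : ℤ → E) :
    Measurable fun y : ℝ => f ⌈(n : ℝ) * y⌉ :=
  (measurable_of_countable f).comp (Int.measurable_ceil.comp (measurable_const_mul (n : ℝ)))

theorem exists_powerBound {p β lam : ℝ} (hβp : β ≤ p + 1) (hβ1 : β ≤ 1) (hlam : 0 < lam) :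
    ∃ K : ℝ≥0, PowerBound β K (fun s y => temperedPower p lam (s - y)) ∧ ∀ n : ℕ, 0 < n →
      PowerBound β K (fun s y => temperedPower p lam (gridDist n s ⌈(n : ℝ) * y⌉)) := by
  obtain ⟨K, hK⟩ := exists_temperedPower_le (sub_le_iff_le_add.2 hβp) (sub_nonpos.2 hβ1) hlam
  have hm := measurable_temperedPower p lam
  refine ⟨K, ⟨fun y => by fun_prop, fun s y => ?_⟩, fun n hn => ⟨fun y => ?_, fun s y => ?_⟩⟩
  · rw [abs_of_nonneg (temperedPower_nonneg _ _ _)]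
    exact hK _ _ fun hpos => ⟨hpos, by linarith⟩
  · exact measurable_comp_ceil n fun k =>
      temperedPower p lam (((k - ⌈(n : ℝ) * y⌉ : ℤ) : ℝ) / n)
  · rw [abs_of_nonneg (temperedPower_nonneg _ _ _)]
    refine hK _ _ fun hpos => ⟨?_, half_sub_le_gridDist hn hpos⟩
    contrapose! hpos
    exact gridDist_nonpos n (sub_nonpos.1 hpos)

end Grid

section GridKernel

/-- The discretization of `kernel H lam t` at the grid point `j / n`: the integrand
`(s - y)_+^(H-3/2) e^(-lam (s-y)_+)` is evaluated at the distance between grid points. -/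
noncomputable def gridKernel (H lam : ℝ) (n : ℕ) (t : ℝ) (j : ℤ) : ℝ :=
  ∫ s in (0 : ℝ)..t, temperedPower (H - 3 / 2) lam (gridDist n s j)

variable {H lam : ℝ}

theorem tendsto_gridKernel (hH : 1 / 2 < H) (hlam : 0 < lam) (t y : ℝ) :
    Tendsto (fun n : ℕ => gridKernel H lam n t ⌈(n : ℝ) * y⌉) atTop (𝓝 (kernel H lam t y)) := by
  have hβ : 0 < min (H - 1 / 2) 1 := lt_min (sub_pos.2 hH) one_pos
  obtain ⟨K, -, hgrid⟩ := exists_powerBound (p := H - 3 / 2) (β := min (H - 1 / 2) 1)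
    ((min_le_left _ _).trans_eq (by ring)) (min_le_right _ _) hlam
  refine intervalIntegral.tendsto_integral_filter_of_dominated_convergence
    (fun s => K * temperedPower (min (H - 1 / 2) 1 - 1) 0 (s - y)) ?_ ?_
    ((intervalIntegrable_power_sub hβ _ _ _).const_mul (K : ℝ))
    (ae_of_all _ fun s _ => tendsto_temperedPower_gridDist _ _ _ _)
  · filter_upwards [eventually_gt_atTop 0] with n hn
    exact ((hgrid n hn).measurable y).aestronglyMeasurable
  · filter_upwards [eventually_gt_atTop 0] with n hn
    exact ae_of_all _ fun s _ => (hgrid n hn).bound s y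

theorem measurable_kernel (hH : 1 / 2 < H) (hlam : 0 < lam) (t : ℝ) :
    Measurable (kernel H lam t) :=
  measurable_of_tendsto_metrizable (fun n => measurable_comp_ceil n (gridKernel H lam n t))
    (tendsto_pi_nhds.2 (tendsto_gridKernel hH hlam t))

theorem memLp_posPower_sub {β : ℝ} (hβ : 0 < β) (hβ1 : β < 1 / 2) {a b : ℝ} (hab : a ≤ b) :
    MemLp (fun y => posPower β (b - y) - posPower β (a - y)) 2 volume := by
  obtain ⟨c, hc⟩ := exists_lintegral_posPower_sub_le hβ hβ1
  have hm := measurable_posPower β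
  refine ⟨by fun_prop, (ENNReal.pow_lt_top_iff.1 ?_).resolve_right two_ne_zero⟩
  rw [sq_eLpNorm_two]
  exact (hc a b hab).trans_lt ENNReal.ofReal_lt_top

theorem memLp_kernel (hH : 1 / 2 < H) (hlam : 0 < lam) {t : ℝ} (ht : 0 ≤ t) :
    MemLp (kernel H lam t) 2 volume := by
  obtain ⟨β, hβ, hβlt⟩ := exists_between (lt_min (sub_pos.2 hH) one_half_pos)
  obtain ⟨hβH, hβ2⟩ := lt_min_iff.1 hβlt
  obtain ⟨K, hker, -⟩ := exists_powerBound (p := H - 3 / 2) (by linarith)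
    (hβ2.le.trans one_half_lt_one.le) hlam
  exact ((memLp_posPower_sub hβ hβ2 ht).const_mul (K : ℝ)).mono'
    (measurable_kernel hH hlam t).aestronglyMeasurable
    (ae_of_all _ fun y => hker.abs_integral_le hβ ht y)

theorem tendsto_integral_gridKernel_sq (hH : 1 / 2 < H) (hlam : 0 < lam) {ι : Type*}
    (s : Finset ι) (a t : ι → ℝ) (ht : ∀ i, 0 ≤ t i) :
    Tendsto (fun n : ℕ => ∫ y, (∑ i ∈ s, a i * gridKernel H lam n (t i) ⌈(n : ℝ) * y⌉) ^ 2) atTop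
      (𝓝 (∫ y, (∑ i ∈ s, a i * kernel H lam (t i) y) ^ 2)) := by
  obtain ⟨β, hβ, hβlt⟩ := exists_between (lt_min (sub_pos.2 hH) one_half_pos)
  obtain ⟨hβH, hβ2⟩ := lt_min_iff.1 hβlt
  obtain ⟨K, -, hgrid⟩ := exists_powerBound (p := H - 3 / 2) (by linarith)
    (hβ2.le.trans one_half_lt_one.le) hlam
  have hdom : MemLp (fun y => ∑ i ∈ s, |a i| *
      (K * (posPower β (t i - y) - posPower β (0 - y)))) 2 volume :=
    memLp_finsetSum _ fun i _ =>
      ((memLp_posPower_sub hβ hβ2 (ht i)).const_mul (K : ℝ)).const_mul |a i|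
  refine tendsto_integral_filter_of_dominated_convergence _ (Eventually.of_forall fun n =>
    (measurable_comp_ceil n fun j => (∑ i ∈ s, a i * gridKernel H lam n (t i) j) ^
      2).aestronglyMeasurable) ?_ hdom.integrable_sq (ae_of_all _ fun y =>
    (tendsto_finsetSum _ fun i _ => (tendsto_gridKernel hH hlam _ y).const_mul (a i)).pow 2)
  filter_upwards [eventually_gt_atTop 0] with n hn
  refine ae_of_all _ fun y => ?_
  rw [norm_pow]
  gcongr
  refine (norm_sum_le _ _).trans (Finset.sum_le_sum fun i _ => ?_)
  rw [norm_mul, Real.norm_eq_abs]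
  gcongr
  exact (hgrid n hn).abs_integral_le hβ (ht i) y

end GridKernel

/-! ### Integrals of functions that are constant between grid points -/

section CeilIntegral

variable {n : ℕ}

theorem ceil_natCast_mul_eq_iff (hn : 0 < n) (y : ℝ) (k : ℤ) :
    ⌈(n : ℝ) * y⌉ = k ↔ y ∈ Set.Ioc (((k : ℝ) - 1) / n) (k / n) := by
  have hn' : (0 : ℝ) < n := Nat.cast_pos.2 hn
  rw [Int.ceil_eq_iff, Set.mem_Ioc, div_lt_iff₀ hn', le_div_iff₀ hn', mul_comm y]

theorem lintegral_comp_ceil (hn : 0 < n) (f : ℤ → ℝ≥0∞) :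
    ∫⁻ y : ℝ, f ⌈(n : ℝ) * y⌉ = ENNReal.ofReal (1 / n) * ∑' j, f j := by
  have hm : Measurable fun y : ℝ => ⌈(n : ℝ) * y⌉ := measurable_comp_ceil n id
  have hcell (j : ℤ) : (fun y : ℝ => ⌈(n : ℝ) * y⌉) ⁻¹' {j} =
      Set.Ioc (((j : ℝ) - 1) / n) (j / n) :=
    Set.ext fun y => ceil_natCast_mul_eq_iff hn y j
  rw [← lintegral_map (μ := volume) (measurable_of_countable f) hm, lintegral_countable',
    mul_comm, ← ENNReal.tsum_mul_right]
  refine tsum_congr fun j => ?_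
  rw [Measure.map_apply hm (measurableSet_singleton j), hcell, Real.volume_Ioc, ← sub_div,
    sub_sub_cancel]

theorem tsum_enorm_sq_eq_lintegral (hn : 0 < n) (g : ℤ → ℝ) :
    ∑' j, ‖(n : ℝ) ^ (-(1 / 2) : ℝ) * g j‖ₑ ^ 2 = ∫⁻ y : ℝ, ‖g ⌈(n : ℝ) * y⌉‖ₑ ^ 2 := by
  have hsq : ‖(n : ℝ) ^ (-(1 / 2) : ℝ)‖ₑ ^ 2 = ENNReal.ofReal (1 / n) := by
    rw [Real.enorm_of_nonneg (by positivity), ← ENNReal.ofReal_pow (by positivity),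
      ← Real.rpow_mul_natCast n.cast_nonneg]
    norm_num [Real.rpow_neg_one]
  simp only [enorm_mul, mul_pow, hsq]
  rw [ENNReal.tsum_mul_left, lintegral_comp_ceil hn fun j => ‖g j‖ₑ ^ 2]

theorem tsum_sq_eq_integral (hn : 0 < n) (g : ℤ → ℝ) :
    ∑' j, ((n : ℝ) ^ (-(1 / 2) : ℝ) * g j) ^ 2 = ∫ y : ℝ, g ⌈(n : ℝ) * y⌉ ^ 2 := by
  have htoReal (x : ℝ) : (‖x‖ₑ ^ 2).toReal = x ^ 2 := by simp
  have h := congrArg ENNReal.toReal (tsum_enorm_sq_eq_lintegral hn g)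
  rw [ENNReal.tsum_toReal_eq fun j => ENNReal.pow_ne_top enorm_ne_top] at h
  simp only [htoReal] at h
  rw [h, ← integral_toReal (measurable_comp_ceil n fun j => ‖g j‖ₑ ^ 2).aemeasurable
    (ae_of_all _ fun y => ENNReal.pow_lt_top enorm_lt_top)]
  simp only [htoReal]

theorem eq_sum_indicator_of_mem_Ioc (hn : 0 < n) (g : ℤ → ℝ) {s : ℝ} (hs : s ∈ Set.Ioc 0 1) :
    g ⌈(n : ℝ) * s⌉ = ∑ k ∈ Finset.range n,
      (Set.Ioc ((k : ℝ) / n) ((k + 1) / n)).indicator (fun _ => g (k + 1)) s := by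
  have hmem (k : ℕ) : s ∈ Set.Ioc ((k : ℝ) / n) ((k + 1) / n) ↔ ⌈(n : ℝ) * s⌉ = k + 1 := by
    rw [ceil_natCast_mul_eq_iff hn]
    push_cast
    rw [add_sub_cancel_right]
  have hpos : 0 < ⌈(n : ℝ) * s⌉ := Int.ceil_pos.2 (mul_pos (Nat.cast_pos.2 hn) hs.1)
  have hle : ⌈(n : ℝ) * s⌉ ≤ n :=
    Int.ceil_le.2 (by exact_mod_cast mul_le_of_le_one_right n.cast_nonneg hs.2)
  obtain ⟨m, hm⟩ := Int.eq_ofNat_of_zero_le (Int.le_sub_one_of_lt hpos)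
  have hceil : ⌈(n : ℝ) * s⌉ = m + 1 := by omega
  rw [Finset.sum_eq_single_of_mem m (Finset.mem_range.2 (by omega)),
    Set.indicator_of_mem ((hmem m).2 hceil), hceil]
  intro k _ hkm
  refine Set.indicator_of_notMem (fun hk => hkm ?_) _
  have := (hmem k).1 hk
  omega

theorem volume_real_Ioc_inter_Ioc_eq_ramp (hn : 0 < n) (k : ℕ) (t : unitInterval) :
    volume.real (Set.Ioc ((k : ℝ) / n) ((k + 1) / n) ∩ Set.Ioc 0 t) = ramp n k t / n := by
  have hn' : (0 : ℝ) < n := Nat.cast_pos.2 hn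
  rw [Set.Ioc_inter_Ioc, max_eq_left (by positivity : (0 : ℝ) ≤ (k : ℝ) / n),
    Real.volume_real_Ioc, ramp_apply, max_comm, eq_div_iff hn'.ne', max_mul_of_nonneg _ _ hn'.le,
    zero_mul, ← min_sub_sub_right, min_mul_of_nonneg _ _ hn'.le]
  congr 2
  · field_simp
    ring
  · field_simp

theorem integral_comp_ceil (hn : 0 < n) (g : ℤ → ℝ) (t : unitInterval) :
    ∫ s in (0 : ℝ)..t, g ⌈(n : ℝ) * s⌉ =
      ∑ k ∈ Finset.range n, ramp n k t / n * g (k + 1) := by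
  rw [intervalIntegral.integral_of_le t.2.1, setIntegral_congr_fun measurableSet_Ioc fun s hs =>
      eq_sum_indicator_of_mem_Ioc hn g ⟨hs.1, hs.2.trans t.2.2⟩,
    integral_finsetSum _ fun k _ => (integrable_const _).indicator measurableSet_Ioc]
  refine Finset.sum_congr rfl fun k _ => ?_
  rw [integral_indicator measurableSet_Ioc, Measure.restrict_restrict measurableSet_Ioc,
    setIntegral_const, smul_eq_mul, volume_real_Ioc_inter_Ioc_eq_ramp hn]

end CeilIntegral

/-! ### The scaled partial sums -/

section Weight

variable {α H lam : ℝ} {n : ℕ}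

/-- The weight with which the innovation `Z j` enters `n^(-H) S_n(n t)`. -/
noncomputable def weight (α H lam : ℝ) (n : ℕ) (t : unitInterval) (j : ℤ) : ℝ :=
  (n : ℝ) ^ (-H) * ∑ k ∈ Finset.range n, ramp n k t * coeff α (lam / n) (k + 1 - j)

theorem summable_coeff (α : ℝ) {μ : ℝ} (hμ : 0 < μ) : Summable (coeff α μ) := by
  have hneg (m : ℕ) : coeff α μ (-m) = 0 := if_neg (by omega)
  refine Summable.of_nat_of_neg (Summable.of_norm_bounded
    ((Real.summable_pow_mul_exp_neg_nat_mul ⌈α⌉₊ hμ).mul_left |1 / Real.Gamma α|) fun m => ?_)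
    (by simp only [hneg, summable_zero])
  rcases m.eq_zero_or_pos with rfl | hm
  · rw [coeff, if_neg (by omega), norm_zero]
    positivity
  have hpow : (m : ℝ) ^ (α - 1) ≤ (m : ℝ) ^ ⌈α⌉₊ := by
    rw [← Real.rpow_natCast]
    exact Real.rpow_le_rpow_of_exponent_le (Nat.one_le_cast.2 hm) (by linarith [Nat.le_ceil α])
  rw [coeff, if_pos (by omega), Int.cast_natCast, mul_assoc, norm_mul, Real.norm_eq_abs,
    Real.norm_of_nonneg (by positivity), neg_mul]
  gcongr

theorem summable_coeff_sub (α : ℝ) {μ : ℝ} (hμ : 0 < μ) (k : ℤ) :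
    Summable fun j => coeff α μ (k - j) :=
  (summable_coeff α hμ).comp_injective sub_right_injective

theorem summable_weight (hlam : 0 < lam) (hn : 0 < n) (t : unitInterval) :
    Summable (weight α H lam n t) := by
  have hcoeff (k : ℕ) := summable_coeff_sub α (div_pos hlam (Nat.cast_pos.2 hn)) (k + 1)
  exact (summable_sum fun k _ => (hcoeff k).mul_left (ramp n k t)).mul_left ((n : ℝ) ^ (-H))

theorem summable_abs_sum_weight (hlam : 0 < lam) (hn : 0 < n) {ι : Type*} (s : Finset ι)
    (a : ι → ℝ) (t : ι → unitInterval) :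
    Summable fun j => |∑ i ∈ s, a i * weight α H lam n (t i) j| :=
  (summable_sum fun i _ => (summable_weight hlam hn (t i)).mul_left (a i)).abs

theorem coeff_div_eq_temperedPower (hn : 0 < n) (j : ℤ) :
    coeff α (lam / n) j =
      1 / Real.Gamma α * (n : ℝ) ^ (α - 1) * temperedPower (α - 1) lam ((j : ℝ) / n) := by
  have hn' : (0 : ℝ) < n := Nat.cast_pos.2 hn
  rcases le_or_gt j 0 with hj | hj
  · rw [coeff, if_neg (by omega), temperedPower_of_nonpos _ _
      (div_nonpos_of_nonpos_of_nonneg (Int.cast_nonpos.2 hj) hn'.le), mul_zero]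
  · have hj' : (0 : ℝ) < j := Int.cast_pos.2 hj
    rw [coeff, if_pos (by omega), temperedPower_of_pos _ _ (by positivity),
      Real.div_rpow hj'.le hn'.le, mul_comm_div]
    field_simp

theorem weight_eq_gridKernel (hH : H = 1 / 2 + α) (hn : 0 < n) (t : unitInterval) (j : ℤ) :
    weight α H lam n t j =
      (n : ℝ) ^ (-(1 / 2) : ℝ) * (1 / Real.Gamma α * gridKernel H lam n t j) := by
  have hn' : (0 : ℝ) < n := Nat.cast_pos.2 hn
  have hscale : (n : ℝ) ^ (-(1 / 2) : ℝ) = (n : ℝ) ^ (-H) * (n : ℝ) ^ (α - 1) * n := by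
    rw [← Real.rpow_add hn', ← Real.rpow_add_one hn'.ne', hH]
    ring_nf
  have hsum : gridKernel H lam n t j = ∑ k ∈ Finset.range n,
      ramp n k t / n * temperedPower (H - 3 / 2) lam (((k + 1 - j : ℤ) : ℝ) / n) :=
    integral_comp_ceil hn (fun i => temperedPower (H - 3 / 2) lam (((i - j : ℤ) : ℝ) / n)) t
  rw [weight, hsum, hscale, Finset.mul_sum, Finset.mul_sum, Finset.mul_sum]
  refine Finset.sum_congr rfl fun k _ => ?_
  rw [coeff_div_eq_temperedPower hn, show H - 3 / 2 = α - 1 by rw [hH]; ring]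
  field_simp

theorem sum_weight_eq_gridKernel (hH : H = 1 / 2 + α) (hn : 0 < n) {ι : Type*} (s : Finset ι)
    (a : ι → ℝ) (t : ι → unitInterval) (j : ℤ) :
    ∑ i ∈ s, a i * weight α H lam n (t i) j = (n : ℝ) ^ (-(1 / 2) : ℝ) *
      (1 / Real.Gamma α * ∑ i ∈ s, a i * gridKernel H lam n (t i) j) := by
  rw [Finset.mul_sum, Finset.mul_sum]
  refine Finset.sum_congr rfl fun i _ => ?_
  rw [weight_eq_gridKernel hH hn]
  ring

theorem exists_tsum_weight_sub_sq_le (hH : H = 1 / 2 + α) (hlam : 0 < lam) {β : ℝ} (hβ : 0 < β)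
    (hβ2 : β < 1 / 2) (hβα : β ≤ α) :
    ∃ c : ℝ≥0, ∀ n : ℕ, 0 < n → ∀ s t : unitInterval,
      ∑' j, ‖weight α H lam n t j - weight α H lam n s j‖ₑ ^ 2 ≤
        ENNReal.ofReal (c * |(t : ℝ) - s| ^ (1 + 2 * β)) := by
  obtain ⟨K, -, hgrid⟩ := exists_powerBound (p := H - 3 / 2) (β := β) (by linarith)
    (by linarith) hlam
  obtain ⟨c, hc⟩ := exists_lintegral_increment_le hβ hβ2 K
  refine ⟨‖1 / Real.Gamma α‖₊ ^ 2 * c, fun n hn s t => ?_⟩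
  have hweight (j : ℤ) : weight α H lam n t j - weight α H lam n s j =
      (n : ℝ) ^ (-(1 / 2) : ℝ) *
        (1 / Real.Gamma α * (gridKernel H lam n t j - gridKernel H lam n s j)) := by
    rw [weight_eq_gridKernel hH hn, weight_eq_gridKernel hH hn]
    ring
  simp only [hweight]
  rw [tsum_enorm_sq_eq_lintegral hn fun j =>
    1 / Real.Gamma α * (gridKernel H lam n t j - gridKernel H lam n s j)]
  simp only [enorm_mul, mul_pow]
  rw [lintegral_const_mul' _ _ (by finiteness), NNReal.coe_mul, mul_assoc,
    ENNReal.ofReal_mul NNReal.zero_le_coe, ENNReal.ofReal_coe_nnreal, ENNReal.coe_pow]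
  exact mul_le_mul_right (hc _ (hgrid n hn) s t) _

theorem tendsto_tsum_weight_sq (hα : 0 < α) (hH : H = 1 / 2 + α) (hlam : 0 < lam) {ι : Type*}
    (s : Finset ι) (a : ι → ℝ) (t : ι → unitInterval) :
    Tendsto (fun n : ℕ => ∑' j, (∑ i ∈ s, a i * weight α H lam n (t i) j) ^ 2) atTop
      (𝓝 ((1 / Real.Gamma α) ^ 2 * ∫ y, (∑ i ∈ s, a i * kernel H lam (t i) y) ^ 2)) := by
  refine ((tendsto_integral_gridKernel_sq (by linarith) hlam s a (fun i => (t i : ℝ))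
    fun i => (t i).2.1).const_mul ((1 / Real.Gamma α) ^ 2)).congr' ?_
  filter_upwards [eventually_gt_atTop 0] with n hn
  simp only [sum_weight_eq_gridKernel hH hn]
  rw [tsum_sq_eq_integral hn fun j =>
    1 / Real.Gamma α * ∑ i ∈ s, a i * gridKernel H lam n (t i) j]
  simp only [mul_pow, integral_const_mul]

theorem exists_abs_weight_le (hα : 0 < α) (hH : H = 1 / 2 + α) (hlam : 0 < lam) :
    ∃ M : ℝ, ∀ n : ℕ, 0 < n → ∀ (t : unitInterval) (j : ℤ),
      |weight α H lam n t j| ≤ (n : ℝ) ^ (-(1 / 2) : ℝ) * M := by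
  have hβ : 0 < min α 1 := lt_min hα one_pos
  obtain ⟨K, -, hgrid⟩ := exists_powerBound (p := H - 3 / 2) (β := min α 1)
    ((min_le_left _ _).trans_eq (by rw [hH]; ring)) (min_le_right _ _) hlam
  refine ⟨|1 / Real.Gamma α| * (K * (1 / min α 1)), fun n hn t j => ?_⟩
  have hceil : ⌈(n : ℝ) * (j / n)⌉ = j := by
    rw [mul_div_cancel₀ _ (Nat.cast_ne_zero.2 hn.ne'), Int.ceil_intCast]
  have hgridKernel : |gridKernel H lam n t j| ≤ K * ((t : ℝ) ^ min α 1 / min α 1) := by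
    simpa only [hceil, gridKernel] using
      (hgrid n hn).abs_integral_zero_le hβ (min_le_right _ _) t.2.1 ((j : ℝ) / n)
  rw [weight_eq_gridKernel hH hn, abs_mul, abs_mul,
    abs_of_nonneg (a := (n : ℝ) ^ _) (by positivity)]
  gcongr
  refine hgridKernel.trans ?_
  gcongr
  exact Real.rpow_le_one t.2.1 t.2.2 hβ.le

theorem eventually_abs_sum_weight_lt (hα : 0 < α) (hH : H = 1 / 2 + α) (hlam : 0 < lam)
    {ι : Type*} (s : Finset ι) (a : ι → ℝ) (t : ι → unitInterval) {δ : ℝ} (hδ : 0 < δ) :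
    ∀ᶠ n : ℕ in atTop, ∀ j, |∑ i ∈ s, a i * weight α H lam n (t i) j| < δ := by
  obtain ⟨M, hM⟩ := exists_abs_weight_le hα hH hlam
  have hlim : Tendsto (fun n : ℕ => ∑ i ∈ s, |a i| * ((n : ℝ) ^ (-(1 / 2) : ℝ) * M)) atTop
      (𝓝 (∑ i ∈ s, |a i| * (0 * M))) :=
    tendsto_finsetSum _ fun i _ => (((tendsto_rpow_neg_atTop one_half_pos).comp
      tendsto_natCast_atTop_atTop).mul_const M).const_mul |a i|
  filter_upwards [eventually_gt_atTop 0, hlim.eventually_lt_const (by simpa using hδ)]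
    with n hn hlt j
  refine ((Finset.abs_sum_le_sum_abs _ _).trans (Finset.sum_le_sum fun i _ => ?_)).trans_lt hlt
  rw [abs_mul]
  gcongr
  exact hM n hn (t i) j

end Weight

section PartialSums

variable {α H lam : ℝ} {Ω : Type*}

theorem scaledPartialSum_eq (Z : ℤ → Ω → ℝ) (n : ℕ) (ω : Ω) :
    scaledPartialSum α H lam Z n ω = ∑ k ∈ Finset.range n,
      ((n : ℝ) ^ (-H) * linearProcess α (lam / n) Z (k + 1) ω) • ramp n k := by
  ext t
  rw [ContinuousMap.sum_apply]
  change (n : ℝ) ^ (-H) * partialSum _ _ = _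
  rw [partialSum_eq _ n (mul_nonneg n.cast_nonneg t.2.1)
    (mul_le_of_le_one_right n.cast_nonneg t.2.2), Finset.mul_sum]
  refine Finset.sum_congr rfl fun k _ => ?_
  rw [ContinuousMap.smul_apply, ramp_apply, smul_eq_mul]
  push_cast
  ring

theorem linearProcess_eq (μ : ℝ) (Z : ℤ → Ω → ℝ) (k : ℤ) (ω : Ω) :
    linearProcess α μ Z k ω = ∑' j, coeff α μ (k - j) * Z j ω := by
  rw [linearProcess, ← (Equiv.subLeft k).tsum_eq]
  simp only [Equiv.subLeft_apply, sub_sub_cancel]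

variable [MeasurableSpace Ω] {P : Measure Ω} [IsProbabilityMeasure P] {Z : ℤ → Ω → ℝ} {v : ℝ≥0}

theorem ae_summable_linearProcess (hZ : IsCenteredIID Z v P) {μ : ℝ} (hμ : 0 < μ) (k : ℤ) :
    ∀ᵐ ω ∂P, Summable fun j => coeff α μ j * Z (k - j) ω := by
  filter_upwards [hZ.ae_summable_mul (summable_coeff_sub α hμ k).abs] with ω hω
  refine ((Equiv.subLeft k).summable_iff.2 hω).congr fun j => ?_
  simp only [Function.comp_apply, Equiv.subLeft_apply, sub_sub_cancel]

theorem aemeasurable_linearProcess (hZ : IsCenteredIID Z v P) {μ : ℝ} (hμ : 0 < μ) (k : ℤ) :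
    AEMeasurable (linearProcess α μ Z k) P := by
  refine aemeasurable_of_tendsto_metrizable_ae (atTop : Filter (Finset ℤ))
    (f := fun s ω => ∑ j ∈ s, coeff α μ j * Z (k - j) ω) (fun s =>
      Finset.aemeasurable_fun_sum _ fun j _ => (hZ.aemeasurable (k - j)).const_mul _) ?_
  filter_upwards [ae_summable_linearProcess hZ hμ k] with ω hω
  exact hω.hasSum

theorem aemeasurable_scaledPartialSum (hZ : IsCenteredIID Z v P) (hlam : 0 < lam) (n : ℕ) :
    AEMeasurable (scaledPartialSum α H lam Z n) P := by
  rw [funext (scaledPartialSum_eq Z n)]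
  refine Finset.aemeasurable_fun_sum _ fun k hk => ?_
  have hn : 0 < n := (Nat.zero_le k).trans_lt (Finset.mem_range.1 hk)
  exact (by fun_prop : Continuous fun x : ℝ => x • ramp n k).measurable.comp_aemeasurable
    ((aemeasurable_linearProcess hZ (div_pos hlam (Nat.cast_pos.2 hn)) _).const_mul _)

theorem ae_hasSum_scaledPartialSum (hZ : IsCenteredIID Z v P) (hlam : 0 < lam) {n : ℕ}
    (hn : 0 < n) : ∀ᵐ ω ∂P, ∀ t : unitInterval,
      HasSum (fun j => weight α H lam n t j * Z j ω) (scaledPartialSum α H lam Z n ω t) := by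
  filter_upwards [ae_all_iff.2 fun k : ℕ => hZ.ae_summable_mul
    (summable_coeff_sub α (div_pos hlam (Nat.cast_pos.2 hn)) ((k : ℤ) + 1)).abs] with ω hω t
  have hsum : HasSum (fun j => ∑ k ∈ Finset.range n, (n : ℝ) ^ (-H) * ramp n k t *
      (coeff α (lam / n) (k + 1 - j) * Z j ω))
      (∑ k ∈ Finset.range n, (n : ℝ) ^ (-H) * ramp n k t *
        linearProcess α (lam / n) Z (k + 1) ω) := by
    refine hasSum_sum fun k _ => ?_
    rw [linearProcess_eq]
    exact (hω k).hasSum.mul_left _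
  convert! hsum using 1
  · funext j
    rw [weight, Finset.mul_sum, Finset.sum_mul]
    exact Finset.sum_congr rfl fun k _ => by ring
  · rw [scaledPartialSum_eq, ContinuousMap.sum_apply]
    refine Finset.sum_congr rfl fun k _ => ?_
    rw [ContinuousMap.smul_apply, smul_eq_mul, mul_right_comm]

theorem exists_incrementBound_scaledPartialSum (hZ : IsCenteredIID Z v P) (hH : H = 1 / 2 + α)
    (hlam : 0 < lam) {β : ℝ} (hβ : 0 < β) (hβ2 : β < 1 / 2) (hβα : β ≤ α) :
    ∃ K : ℝ≥0, ∀ n : ℕ, 0 < n →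
      IncrementBound P (fun t ω => scaledPartialSum α H lam Z n ω t) K (2 * β) := by
  obtain ⟨c, hc⟩ := exists_tsum_weight_sub_sq_le hH hlam hβ hβ2 hβα
  refine ⟨v * c, fun n hn s t => ?_⟩
  calc ∫⁻ ω, ‖scaledPartialSum α H lam Z n ω t - scaledPartialSum α H lam Z n ω s‖ₑ ^ 2 ∂P
      = ∫⁻ ω, ‖∑' j, (weight α H lam n t j - weight α H lam n s j) * Z j ω‖ₑ ^ 2 ∂P := by
        refine lintegral_congr_ae ?_
        filter_upwards [ae_hasSum_scaledPartialSum (α := α) (H := H) hZ hlam hn] with ω hω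
        simp only [sub_mul, ((hω t).sub (hω s)).tsum_eq]
    _ ≤ v * ∑' j, ‖weight α H lam n t j - weight α H lam n s j‖ₑ ^ 2 :=
        hZ.lintegral_tsum_mul_sq_le
          ((summable_weight hlam hn t).sub (summable_weight hlam hn s)).abs
    _ ≤ v * ENNReal.ofReal (c * |(t : ℝ) - s| ^ (1 + 2 * β)) := by
        gcongr
        exact hc n hn s t
    _ = ENNReal.ofReal ((v * c : ℝ≥0) * |(t : ℝ) - s| ^ (1 + 2 * β)) := by
        rw [NNReal.coe_mul, mul_assoc, ENNReal.ofReal_mul v.coe_nonneg, ENNReal.ofReal_coe_nnreal]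

theorem integral_exp_scaledPartialSum_eq (hZ : IsCenteredIID Z v P) (hlam : 0 < lam) {n : ℕ}
    (hn : 0 < n) {ι : Type*} (s : Finset ι) (a : ι → ℝ) (t : ι → unitInterval) :
    ∫ ω, Complex.exp
        ((∑ i ∈ s, a i * scaledPartialSum α H lam Z n ω (t i) : ℝ) * Complex.I) ∂P =
      ∫ ω, Complex.exp
        ((∑' j, (∑ i ∈ s, a i * weight α H lam n (t i) j) * Z j ω : ℝ) * Complex.I) ∂P := by
  refine integral_congr_ae ?_
  filter_upwards [ae_hasSum_scaledPartialSum (α := α) (H := H) hZ hlam hn] with ω hω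
  rw [← (hasSum_sum fun i _ => (hω (t i)).mul_left (a i)).tsum_eq]
  simp only [Finset.sum_mul, mul_assoc]

theorem tendsto_integral_exp_scaledPartialSum (hZ : IsCenteredIID Z v P) (hα : 0 < α)
    (hH : H = 1 / 2 + α) (hlam : 0 < lam) {ι : Type*} (s : Finset ι) (a : ι → ℝ)
    (t : ι → unitInterval) :
    Tendsto (fun n => ∫ ω, Complex.exp
      ((∑ i ∈ s, a i * scaledPartialSum α H lam Z n ω (t i) : ℝ) * Complex.I) ∂P) atTop
      (𝓝 (Complex.exp (-(v * ((1 / Real.Gamma α) ^ 2 *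
        ∫ y, (∑ i ∈ s, a i * kernel H lam (t i) y) ^ 2) / 2) : ℝ))) := by
  set σ := (1 / Real.Gamma α) ^ 2 * ∫ y, (∑ i ∈ s, a i * kernel H lam (t i) y) ^ 2
  have hσ : 0 ≤ σ := mul_nonneg (sq_nonneg _) (integral_nonneg fun _ => sq_nonneg _)
  have hlim := tendsto_tsum_weight_sq hα hH hlam s a t
  have hgauss : Continuous fun x : ℝ => Complex.exp (-(v * x / 2) : ℝ) := by fun_prop
  refine tendsto_of_tendsto_of_dist ((hgauss.tendsto σ).comp hlim) (Metric.tendsto_nhds.2 ?_)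
  intro ε hε
  obtain ⟨δ, hδ, hclose⟩ := hZ.exists_norm_integral_exp_tsum_sub_le
    (show 0 < ε / (σ + 1) by positivity)
  filter_upwards [eventually_gt_atTop 0, eventually_abs_sum_weight_lt hα hH hlam s a t hδ,
    hlim.eventually_lt_const (lt_add_one σ)] with n hn hsmall hlt
  rw [integral_exp_scaledPartialSum_eq hZ hlam hn, Real.dist_eq, sub_zero,
    abs_of_nonneg dist_nonneg, dist_comm, dist_eq_norm]
  calc _ ≤ ε / (σ + 1) * ∑' j, (∑ i ∈ s, a i * weight α H lam n (t i) j) ^ 2 :=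
        hclose _ (summable_abs_sum_weight hlam hn s a t) hsmall
    _ < ε / (σ + 1) * (σ + 1) := by gcongr
    _ = ε := by field_simp

end PartialSums

/-! ### The tempered Hermite process -/

section Limit

variable {Ω : Type*} [MeasurableSpace Ω] {P : Measure Ω} {B : Set ℝ → Ω → ℝ} {v : ℝ≥0}
  {α H lam : ℝ}
  [IsProbabilityMeasure P]

theorem exists_isTemperedHermite (hB : IsGaussianRandomMeasure B v P) (hlam : 0 < lam) {β : ℝ}
    (hβ : 0 < β) (hβ2 : β < 1 / 2) (hβH : β ≤ H - 1 / 2) :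
    ∃ ζ : Ω → C(unitInterval, ℝ), IsTemperedHermite B P H lam ζ ∧
      ∃ K : ℝ≥0, IncrementBound P (fun t ω => ζ ω t) K (2 * β) := by
  obtain ⟨K, hker, -⟩ := exists_powerBound (p := H - 3 / 2) (β := β) (by linarith)
    (by linarith) hlam
  obtain ⟨c, hc⟩ := exists_lintegral_increment_le hβ hβ2 K
  choose X hX using fun t : unitInterval =>
    hB.exists_isWienerIntegral (memLp_kernel (H := H) (by linarith) hlam t.2.1)
  have hinc : IncrementBound P X (v * c) (2 * β) := by
    intro s t
    rw [((hX t).sub (hX s) hB).lintegral_sq hB, NNReal.coe_mul, mul_assoc,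
      ENNReal.ofReal_mul v.coe_nonneg, ENNReal.ofReal_coe_nnreal]
    exact mul_le_mul_right (hc _ hker s t) _
  obtain ⟨ζ, hζ, hζX⟩ := exists_continuous_version (fun t => (hX t).2.1) (by positivity) hinc
  exact ⟨ζ, ⟨hζ, fun t => (hX t).congr_ae (hζX t).symm⟩, v * c, hinc.congr hζX⟩

theorem integral_exp_temperedHermite (hB : IsGaussianRandomMeasure B v P)
    {ζ : Ω → C(unitInterval, ℝ)} (hζ : IsTemperedHermite B P H lam ζ) (c : ℝ)
    {ι : Type*} (s : Finset ι) (a : ι → ℝ) (t : ι → unitInterval) :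
    ∫ ω, Complex.exp ((∑ i ∈ s, a i * (c • ζ ω) (t i) : ℝ) * Complex.I) ∂P =
      Complex.exp
        (-(v * (c ^ 2 * ∫ y, (∑ i ∈ s, a i * kernel H lam (t i) y) ^ 2) / 2) : ℝ) := by
  have h := ((IsWienerIntegral.finsetSum hB s a fun i => hζ.2 (t i)).const_mul hB c).integral_exp hB
  simp only [mul_pow, integral_const_mul] at h
  rw [← h]
  simp only [ContinuousMap.smul_apply, smul_eq_mul, Finset.mul_sum, mul_left_comm c]

end Limit

end TemperedHermite

theorem theorem5p3 {Ω Ω' : Type*} [MeasurableSpace Ω] [MeasurableSpace Ω']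
    (P : Measure Ω) [IsProbabilityMeasure P] (P' : Measure Ω') [IsProbabilityMeasure P']
    (α H lam : ℝ) (hα : 0 < α) (hH : H = 1 / 2 + α) (hlam : 0 < lam)
    (Z : ℤ → Ω → ℝ) (hindep : iIndepFun Z P) (hident : ∀ j, IdentDistrib (Z j) (Z 0) P P)
    (hL2 : MemLp (Z 0) 2 P) (hmean : ∫ ω, Z 0 ω ∂P = 0)
    (v : ℝ≥0) (hv : ∫ ω, Z 0 ω ^ 2 ∂P = v)
    (B : Set ℝ → Ω' → ℝ) (hB : TemperedHermite.IsGaussianRandomMeasure B v P') :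
    -- the series that define the linear processes converge absolutely, almost surely
    (∀ n : ℕ, 1 ≤ n → ∀ k : ℤ, ∀ᵐ ω ∂P,
      Summable (fun j : ℤ => TemperedHermite.coeff α (lam / n) j * Z (k - j) ω)) ∧
    -- weak convergence in `C[0,1]` to the tempered Hermite process, normalized by `1 / Γ(α)`
    (∃ ζ : Ω' → C(unitInterval, ℝ), TemperedHermite.IsTemperedHermite B P' H lam ζ ∧
      TendstoInDistribution (fun (n : ℕ) (ω : Ω) => TemperedHermite.scaledPartialSum α H lam Z n ω)
        atTop (fun ω => (1 / Real.Gamma α) • ζ ω) (fun _ => P) P') ∧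
    -- the bound on the second moments of the increments
    (H < 1 → ∃ C : ℝ, ∀ n : ℕ, 1 ≤ n → ∀ t₁ t₂ : unitInterval,
      ∫⁻ ω, ‖TemperedHermite.scaledPartialSum α H lam Z n ω t₂ -
          TemperedHermite.scaledPartialSum α H lam Z n ω t₁‖ₑ ^ 2 ∂P ≤
        ENNReal.ofReal (C * |(t₂ : ℝ) - t₁| ^ (2 * H))) := by
  have hZ := TemperedHermite.isCenteredIID_of_identDistrib hindep 0 hident hL2 hmean hv
  refine ⟨fun n hn k => TemperedHermite.ae_summable_linearProcess hZ
    (div_pos hlam (Nat.cast_pos.2 hn)) k, ?_, fun hH1 => ?_⟩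
  · obtain ⟨β, hβ, hβmin⟩ := exists_between (lt_min hα one_half_pos)
    obtain ⟨hβα, hβ2⟩ := lt_min_iff.1 hβmin
    obtain ⟨ζ, hζ, K, hζinc⟩ := TemperedHermite.exists_isTemperedHermite hB (H := H) hlam hβ hβ2
      (by linarith)
    obtain ⟨C, hSinc⟩ :=
      TemperedHermite.exists_incrementBound_scaledPartialSum hZ hH hlam hβ hβ2 hβα.le
    refine ⟨ζ, hζ, TemperedHermite.tendstoInDistribution_of_charFun
      (K := max C (‖1 / Real.Gamma α‖₊ ^ 2 * K)) (γ := 2 * β)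
      (TemperedHermite.aemeasurable_scaledPartialSum hZ hlam) (hζ.1.fun_const_smul _)
      (by positivity) ?_ ((hζinc.const_mul _).mono (le_max_right _ _)) fun N a t => ?_⟩
    · filter_upwards [eventually_gt_atTop 0] with n hn
      exact (hSinc n hn).mono (le_max_left _ _)
    · rw [TemperedHermite.integral_exp_temperedHermite hB hζ]
      exact TemperedHermite.tendsto_integral_exp_scaledPartialSum hZ hα hH hlam _ a t
  · obtain ⟨C, hSinc⟩ := TemperedHermite.exists_incrementBound_scaledPartialSum hZ hH hlam hα
      (by linarith) le_rfl
    refine ⟨C, fun n hn t₁ t₂ => ?_⟩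
    rw [show 2 * H = 1 + 2 * α by rw [hH]; ring]
    exact hSinc n hn t₁ t₂
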